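/- Comparison functions are continuous functions $\alpha:[0,\infty)\to[0,\infty)$: $\alpha\in\mathcal P$ if $\alpha(r)>0$ for $r>0$; $\alpha\in\mathcal{PD}$ if in addition $\alpha(0)=0$; $\alpha\in\mathcal K$ if it is strictly increasing with $\alpha(0)=0$; $\alpha\in\mathcal K_\infty$ if in addition it is unbounded. $\beta\in\mathcal{KL}$ if $\beta:[0,\infty)^2\to[0,\infty)$ is continuous, $\beta(\cdot,t)\in\mathcal K$ for each $t\ge 0$, and for each $s>0$ the function $\beta(s,\cdot)$ is decreasing (not necessarily strictly) with limit $0$ at infinity. $|\cdot|$ is the Euclidean norm. A system $\dot\xi=f(\xi,u)$ is input-to-state stable (ISS) with state $\xi$ and input $u$ if there are $\beta\in\mathcal{KL}$ and $\chi\in\mathcal K$ such that, for every initial state and every measurable, locally essentially bounded input $u:[0,\infty)\to\mathbb R^k$, a solution exists for all $t\ge 0$ and every solution satisfies $|\xi(t)|\le\max\{\beta(|\xi(0)|,t),\chi(\|u\|_\infty)\}$. Consider the system $$\dot x=\rho_s(x,z,d)\,g_s(x,z,d),\qquad \dot z=\rho_f(z,x,w)\,g_f(z,x,w),$$ with $x\in\mathbb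 R^n$, $z\in\mathbb R^m$, $d\in\mathbb R^p$, $w\in\mathbb R^q$, $\rho_s,\rho_f\ge 0$, whose right-hand sides are locally Lipschitz in $(x,z)$, uniformly for $d$ and $w$, respectively, in bounded sets, and, for each fixed $(x,z)$, measurable and bounded on bounded sets as functions of $d$ and $w$, respectively (for example, piecewise continuous in $d$ and $w$). Assumption 1. $\varphi:\mathbb R^n\to\mathbb R^m$ is locally Lipschitz, $g_s(0,\varphi(0),0)=0$, and $g_f(\varphi(x),x,0)=0$ for all $x$. Assumption 2. $V_s:\mathbb R^n\to[0,\infty)$ and $V_f:\mathbb R^m\times\mathbb R^n\to[0,\infty)$ are continuously differentiable, and there are $\underline\alpha_s,\overline\alpha_s,\gamma_s,\chi_s,\underline\alpha_f,\overline\alpha_f,\chi_f\in\mathcal K_\infty$ and $\alpha_s,\alpha_f,\lambda_{f1},\lambda_{f2}\in\mathcal{PD}$, with $\lambda_{f2}$ nondecreasing, such that for all $x,z,d,w$ $$\underline\alpha_s(|x|)\le V_s(x)\le\overline\alpha_s(|x|),$$ $$V_s(x)\ge\max\{\gamma_s(V_f(z,x)),\chi_s(|d|)\}\ \Rightarrow\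 \frac{\partial V_s(x)}{\partial x}g_s(x,z,d)\le-\alpha_s(V_s(x)),$$ $$\underline\alpha_f(|z-\varphi(x)|)\le V_f(z,x)\le\overline\alpha_f(|z-\varphi(x)|),$$ $$V_f(z,x)\ge\chi_f(|w|)\ \Rightarrow\ \frac{\partial V_f(z,x)}{\partial z}g_f(z,x,w)\le-\alpha_f(V_f(z,x)),$$ $$\left|\frac{\partial V_f(z,x)}{\partial x}\right|\le\lambda_{f1}(V_f(z,x))+\lambda_{f2}(V_s(x)).$$ Theorem. Let Assumptions 1 and 2 hold and suppose: 1. there is $\underline\rho_s\in\mathcal P$ such that, for all $x,z,d$, $V_s(x)\ge\max\{\gamma_s(V_f(z,x)),\chi_s(|d|)\}$ implies $\rho_s(x,z,d)\ge\underline\rho_s(V_s(x))$; 2. there are $\gamma_f\in\mathcal K_\infty$ and $\overline\rho_s,\underline\rho_f\in\mathcal P$ such that, for all $r>0$, $$\gamma_f(\gamma_s(r))<r,\qquad \overline\rho_s(r)\big(\lambda_{f1}(r)+\lambda_{f2}(\gamma_f^{-1}(r))\big)<\underline\rho_f(r)\alpha_f(r),$$ and, for all $x,z,d,w$, $V_f(z,x)\ge\max\{\gamma_f(V_s(x)),\gamma_f(\chi_s(|d|)),\chi_f(|w|)\}$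 implies $$\rho_s(x,z,d)\,|g_s(x,z,d)|\le\overline\rho_s(V_f(z,x))\quad\text{and}\quad\rho_f(z,x,w)\ge\underline\rho_f(V_f(z,x)).$$ Then the system is ISS with state $(x,z-\varphi(0))$ and input $(d,w)$. Moreover, there exists $\sigma\in\mathcal K_\infty$ that is continuously differentiable on $(0,\infty)$ with positive derivative there and satisfies $\gamma_s(r)<\sigma(r)<\gamma_f^{-1}(r)$ for all $r>0$; and for every such $\sigma$ the function $$V(x,z)=\max\{V_s(x),\sigma(V_f(z,x))\}$$ is positive definite and radially unbounded with respect to $(x,z-\varphi(x))$ (it lies between two $\mathcal K_\infty$ functions of $|(x,z-\varphi(x))|$), and there is $\alpha\in\mathcal{PD}$ such that, at every $(x,z)$ where $V$ is differentiable and for all $d,w$, $V(x,z)\ge\max\{\chi_s(|d|),\sigma(\chi_f(|w|))\}$ implies $$\frac{\partial V(x,z)}{\partial x}\rho_s(x,z,d)g_s(x,z,d)+\frac{\partial V(x,z)}{\partial z}\rho_f(z,x,w)g_f(z,x,w)\le-\alpha(V(x,z)).$$ -/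

import Mathlib

open Set Filter Topology MeasureTheory

/-- The Euclidean space of real vectors with `k` components, with the Euclidean norm. -/
abbrev Euc (k : ℕ) : Type := EuclideanSpace ℝ (Fin k)

/-- The Cartesian product of two Euclidean spaces with the Euclidean norm of the stacked vector. -/
abbrev EucProd (k l : ℕ) : Type := WithLp 2 (Euc k × Euc l)

/-! Comparison functions. A function on `[0, ∞)` is represented by a function `ℝ → ℝ` of which
only the restriction to `[0, ∞)` is relevant. -/

/-- Class `𝒫`: continuous, positive on `(0, ∞)`, nonnegative at `0`. -/
structure ClassP (α : ℝ → ℝ) : Prop where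
  cont : ContinuousOn α (Ici 0)
  pos : ∀ r, 0 < r → 0 < α r
  zero_nonneg : 0 ≤ α 0

/-- Class `𝒫𝒟`: continuous, positive on `(0, ∞)`, zero at `0`. -/
structure ClassPD (α : ℝ → ℝ) : Prop where
  cont : ContinuousOn α (Ici 0)
  pos : ∀ r, 0 < r → 0 < α r
  zero : α 0 = 0

/-- Class `𝒦`: continuous, strictly increasing, zero at `0`. -/
structure ClassK (α : ℝ → ℝ) : Prop where
  cont : ContinuousOn α (Ici 0)
  strictMono : StrictMonoOn α (Ici 0)
  zero : α 0 = 0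

/-- Class `𝒦∞`: of class `𝒦` and unbounded. -/
structure ClassKInf (α : ℝ → ℝ) : Prop extends ClassK α where
  unbounded : Tendsto α atTop atTop

/-- Class `𝒦ℒ`. -/
structure ClassKL (β : ℝ → ℝ → ℝ) : Prop where
  cont : ContinuousOn (fun a : ℝ × ℝ => β a.1 a.2) (Ici 0 ×ˢ Ici 0)
  classK : ∀ t, 0 ≤ t → ClassK (fun s => β s t)
  anti : ∀ s, 0 < s → AntitoneOn (β s) (Ici 0)
  tendsto : ∀ s, 0 < s → Tendsto (β s) atTop (𝓝 0)

/-- The inverse `γ⁻¹ : [0, ∞) → [0, ∞)` of a function `γ` of class `𝒦∞`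
(which is a bijection of `[0, ∞)` onto itself). -/
noncomputable def kInv (γ : ℝ → ℝ) : ℝ → ℝ := Function.invFunOn γ (Ici 0)

section ISS

variable {X U : Type*} [NormedAddCommGroup X] [NormedSpace ℝ X] [NormedAddCommGroup U]

/-- An admissible input on `[0, ∞)`: measurable and locally essentially bounded. -/
def IsInput (u : ℝ → U) : Prop :=
  AEStronglyMeasurable u (volume.restrict (Ici 0)) ∧
    ∀ T : ℝ, ∃ c : ℝ, ∀ᵐ t ∂(volume.restrict (Icc 0 T)), ‖u t‖ ≤ c

/-- `ξ` is a (Carathéodory) solution of `ξ' = f(ξ, u)` on `[0, T]`, in integrated form. -/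
def IsSolutionOn (f : X → U → X) (u : ℝ → U) (T : ℝ) (ξ : ℝ → X) : Prop :=
  ∀ t ∈ Icc 0 T, IntervalIntegrable (fun s => f (ξ s) (u s)) volume 0 t ∧
    ξ t = ξ 0 + ∫ s in (0 : ℝ)..t, f (ξ s) (u s)

/-- Input-to-state stability of `ξ' = f(ξ, u)`. There are `β ∈ 𝒦ℒ` and `χ ∈ 𝒦` such that, for every
input and every initial state, a solution exists on all of `[0, ∞)`, and every solution satisfies
`|ξ(t)| ≤ max {β(|ξ(0)|, t), χ(‖u‖_∞)}` as long as it is defined. Here `c` ranges over the essential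
bounds of `u` on `[0, ∞)`, the least of which, if there is one, is `‖u‖_∞`. -/
def IsISS (f : X → U → X) : Prop :=
  ∃ (β : ℝ → ℝ → ℝ) (χ : ℝ → ℝ), ClassKL β ∧ ClassK χ ∧
    ∀ u : ℝ → U, IsInput u →
      (∀ ξ₀ : X, ∃ ξ : ℝ → X, ξ 0 = ξ₀ ∧ ∀ T, 0 ≤ T → IsSolutionOn f u T ξ) ∧
      ∀ (T : ℝ) (ξ : ℝ → X), IsSolutionOn f u T ξ →
        ∀ c : ℝ, (∀ᵐ t ∂(volume.restrict (Ici 0)), ‖u t‖ ≤ c) →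
          ∀ t ∈ Icc 0 T, ‖ξ t‖ ≤ max (β ‖ξ 0‖ t) (χ c)

/-- Regularity of a right-hand side `f(x, u)`: locally Lipschitz in the state `x`, uniformly for `u` in
bounded sets; measurable and bounded on bounded sets as a function of the input value `u`. This covers
functions that are locally Lipschitz in `x` and continuous or piecewise continuous in `u`. -/
structure RegularRHS {S Y : Type*} [NormedAddCommGroup S] [NormedAddCommGroup Y]
    [MeasurableSpace U] [MeasurableSpace Y] (f : S → U → Y) : Prop where
  lipschitz : ∀ (x₀ : S) (R : ℝ), ∃ δ > 0, ∃ K : ℝ, ∀ u : U, ‖u‖ ≤ R →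
    ∀ x ∈ Metric.ball x₀ δ, ∀ y ∈ Metric.ball x₀ δ, ‖f x u - f y u‖ ≤ K * ‖x - y‖
  measurable : ∀ x : S, Measurable (f x)
  bounded : ∀ (x : S) (R : ℝ), ∃ B : ℝ, ∀ u : U, ‖u‖ ≤ R → ‖f x u‖ ≤ B

end ISS

section System

variable {n m p q : ℕ}

/-- The system `x' = ρs(x,z,d) gs(x,z,d)`, `z' = ρf(z,x,w) gf(z,x,w)` written with state
`(x, z - z₀)` and input `(d, w)`. -/
noncomputable def shiftedSystem
    (ρs : Euc n → Euc m → Euc p → ℝ) (gs : Euc n → Euc m → Euc p → Euc n)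
    (ρf : Euc m → Euc n → Euc q → ℝ) (gf : Euc m → Euc n → Euc q → Euc m) (z₀ : Euc m)
    (ξ : EucProd n m) (u : EucProd p q) : EucProd n m :=
  WithLp.toLp 2
    (ρs ξ.fst (ξ.snd + z₀) u.fst • gs ξ.fst (ξ.snd + z₀) u.fst,
     ρf (ξ.snd + z₀) ξ.fst u.snd • gf (ξ.snd + z₀) ξ.fst u.snd)

/-- Steady-state assumption: `φ` is locally Lipschitz, `gs(0, φ(0), 0) = 0`, and `gf(φ(x), x, 0) = 0`
for all `x`. -/
structure SteadyState (gs : Euc n → Euc m → Euc p → Euc n) (gf : Euc m → Euc n → Euc q → Euc m)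
    (φ : Euc n → Euc m) : Prop where
  lipschitz : LocallyLipschitz φ
  slow : gs 0 (φ 0) 0 = 0
  fast : ∀ x, gf (φ x) x 0 = 0

/-- Lyapunov assumption on the reduced-order subsystem `x' = gs(x, z, d)`. -/
structure SlowLyapunov (gs : Euc n → Euc m → Euc p → Euc n)
    (Vs : Euc n → ℝ) (Vf : Euc m → Euc n → ℝ) (αsl αsu γs χs αs : ℝ → ℝ) : Prop where
  contDiff : ContDiff ℝ 1 Vs
  lower_class : ClassKInf αsl
  upper_class : ClassKInf αsu
  gain_class : ClassKInf γs
  input_gain_class : ClassKInf χs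
  decay_class : ClassPD αs
  lower : ∀ x, αsl ‖x‖ ≤ Vs x
  upper : ∀ x, Vs x ≤ αsu ‖x‖
  decay : ∀ x z d, max (γs (Vf z x)) (χs ‖d‖) ≤ Vs x →
    fderiv ℝ Vs x (gs x z d) ≤ -αs (Vs x)

/-- Lyapunov assumption on the boundary-layer subsystem `z' = gf(z, x, w)`. -/
structure FastLyapunov (gf : Euc m → Euc n → Euc q → Euc m) (φ : Euc n → Euc m)
    (Vs : Euc n → ℝ) (Vf : Euc m → Euc n → ℝ) (αfl αfu χf αf lf1 lf2 : ℝ → ℝ) : Prop where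
  contDiff : ContDiff ℝ 1 (fun a : Euc m × Euc n => Vf a.1 a.2)
  lower_class : ClassKInf αfl
  upper_class : ClassKInf αfu
  input_gain_class : ClassKInf χf
  decay_class : ClassPD αf
  cross1_class : ClassPD lf1
  cross2_class : ClassPD lf2
  cross2_mono : MonotoneOn lf2 (Ici 0)
  lower : ∀ z x, αfl ‖z - φ x‖ ≤ Vf z x
  upper : ∀ z x, Vf z x ≤ αfu ‖z - φ x‖
  decay : ∀ z x w, χf ‖w‖ ≤ Vf z x →
    fderiv ℝ (fun z' => Vf z' x) z (gf z x w) ≤ -αf (Vf z x)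
  cross : ∀ z x, ‖fderiv ℝ (fun x' => Vf z x') x‖ ≤ lf1 (Vf z x) + lf2 (Vs x)

/-- `σ ∈ 𝒦∞` is continuously differentiable on `(0, ∞)` with positive derivative there, and
`γs(r) < σ(r) < γf⁻¹(r)` for all `r > 0`. -/
structure ScalingFunction (γs γf σ : ℝ → ℝ) : Prop where
  classKInf : ClassKInf σ
  contDiffOn : ContDiffOn ℝ 1 σ (Ioi 0)
  deriv_pos : ∀ r, 0 < r → 0 < deriv σ r
  lower : ∀ r, 0 < r → γs r < σ r
  upper : ∀ r, 0 < r → σ r < kInv γf r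

/-- The composite function `V(x, z) = max {Vs(x), σ(Vf(z, x))}`. -/
noncomputable def maxLyapunov (Vs : Euc n → ℝ) (Vf : Euc m → Euc n → ℝ) (σ : ℝ → ℝ)
    (x : Euc n) (z : Euc m) : ℝ :=
  max (Vs x) (σ (Vf z x))

/-- `V` is positive definite and radially unbounded with respect to `(x, z - φ(x))`, in the quantitative
form `α₁(|(x, z - φ(x))|) ≤ V(x, z) ≤ α₂(|(x, z - φ(x))|)` with `α₁, α₂ ∈ 𝒦∞`. -/
def PosDefRadiallyUnbounded (φ : Euc n → Euc m) (V : Euc n → Euc m → ℝ) : Prop :=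
  ∃ α₁ α₂ : ℝ → ℝ, ClassKInf α₁ ∧ ClassKInf α₂ ∧ ∀ x z,
    α₁ ‖(WithLp.toLp 2 (x, z - φ x) : EucProd n m)‖ ≤ V x z ∧
    V x z ≤ α₂ ‖(WithLp.toLp 2 (x, z - φ x) : EucProd n m)‖

end System

/-! ### Calculus of class 𝒦 and 𝒦∞ functions and their inverses. -/

section Comparison

variable {α γ : ℝ → ℝ} {r s : ℝ}

/-! A maximum of two Lyapunov functions decays as soon as whichever one is active decays. The
small-gain inequality says `γs < γf⁻¹`, which leaves room for a `C¹` function `σ` strictly between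
them (`exists_scalingFunction`). If `Vs` is active, then `γs(Vf) ≤ σ(Vf) ≤ Vs`, so the slow decay
condition applies. If `σ(Vf)` is active, then `Vs ≤ σ(Vf) ≤ γf⁻¹(Vf)`, so the fast conditions apply;
the motion of `x` then raises `Vf` at a rate of at most `ρsu (lf1 + lf2 ∘ γf⁻¹)`, which the decay
`ρfl αf` strictly dominates. Both cases give one rate that is a continuous positive function of `V`
(`exists_decay_rate`). Where `V` is differentiable, its derivative is that of an active component,
because this component touches `V` from below (`fderiv_eq_of_le_of_eq`).

For ISS, a rescaling `κ` turns the rate into an exponential one (`exists_exponential_rescaling`).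
Along a solution, `κ(V)` is Lipschitz on compact intervals where it is positive, so the
almost-everywhere decay integrates (`exp_mul_max_le`), and `κ(V)` stays below the maximum of a
decaying exponential and an input threshold (`le_max_exp_of_decay`). The same estimate bounds every
local solution a priori, and hence yields global existence by Picard iteration for a cut-off system
(`RegularRHS.exists_global_solution`). Finally, `V` is comparable to `|(x, z - φ(x))|`, and a growth
modulus of `φ` converts this into `|(x, z - φ(0))|`. -/

theorem ClassK.nonneg (h : ClassK α) (hr : 0 ≤ r) : 0 ≤ α r := by
  rw [← h.zero]
  exact h.strictMono.monotoneOn self_mem_Ici hr hr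

theorem ClassK.pos (h : ClassK α) (hr : 0 < r) : 0 < α r := by
  rw [← h.zero]
  exact h.strictMono self_mem_Ici hr.le hr

theorem ClassK.mono (h : ClassK α) (hr : 0 ≤ r) (hrs : r ≤ s) : α r ≤ α s :=
  h.strictMono.monotoneOn hr (hr.trans hrs) hrs

theorem ClassK.lt (h : ClassK α) (hr : 0 ≤ r) (hrs : r < s) : α r < α s :=
  h.strictMono hr (hr.trans hrs.le) hrs

theorem ClassK.le_iff (h : ClassK α) (hr : 0 ≤ r) (hs : 0 ≤ s) : α r ≤ α s ↔ r ≤ s :=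
  h.strictMono.le_iff_le hr hs

theorem ClassK.lt_iff (h : ClassK α) (hr : 0 ≤ r) (hs : 0 ≤ s) : α r < α s ↔ r < s :=
  h.strictMono.lt_iff_lt hr hs

theorem ClassK.mapsTo (h : ClassK α) : MapsTo α (Ici 0) (Ici 0) := fun _ hr => h.nonneg hr

theorem ClassKInf.surjOn (h : ClassKInf γ) : SurjOn γ (Ici 0) (Ici 0) := by
  intro y hy
  obtain ⟨b, hb, hb0⟩ := ((h.unbounded.eventually_ge_atTop y).and (eventually_ge_atTop 0)).exists
  have := intermediate_value_Icc hb0 (h.cont.mono Icc_subset_Ici_self)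
  obtain ⟨x, hx, rfl⟩ := this (show y ∈ Icc (γ 0) (γ b) from ⟨by rw [h.zero]; exact hy, hb⟩)
  exact ⟨x, hx.1, rfl⟩

theorem ClassKInf.kInv_nonneg (h : ClassKInf γ) (hr : 0 ≤ r) : 0 ≤ kInv γ r :=
  Function.invFunOn_mem (h.surjOn hr)

theorem ClassKInf.apply_kInv (h : ClassKInf γ) (hr : 0 ≤ r) : γ (kInv γ r) = r :=
  Function.invFunOn_eq (h.surjOn hr)

theorem ClassKInf.kInv_apply (h : ClassKInf γ) (hr : 0 ≤ r) : kInv γ (γ r) = r :=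
  h.strictMono.injOn (h.kInv_nonneg (h.nonneg hr)) hr (h.apply_kInv (h.nonneg hr))

theorem ClassKInf.lt_kInv_iff (h : ClassKInf γ) (hr : 0 ≤ r) (hs : 0 ≤ s) :
    r < kInv γ s ↔ γ r < s := by
  rw [← h.lt_iff hr (h.kInv_nonneg hs), h.apply_kInv hs]

theorem ClassKInf.kInv_lt_iff (h : ClassKInf γ) (hr : 0 ≤ r) (hs : 0 ≤ s) :
    kInv γ s < r ↔ s < γ r := by
  rw [← h.lt_iff (h.kInv_nonneg hs) hr, h.apply_kInv hs]

theorem ClassKInf.le_kInv_iff (h : ClassKInf γ) (hr : 0 ≤ r) (hs : 0 ≤ s) :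
    r ≤ kInv γ s ↔ γ r ≤ s := by
  rw [← h.le_iff hr (h.kInv_nonneg hs), h.apply_kInv hs]

theorem ClassKInf.kInv (h : ClassKInf γ) : ClassKInf (kInv γ) where
  cont := by
    intro y hy
    refine tendsto_order.2 ⟨fun a ha => ?_, fun b hb => ?_⟩
    · rcases lt_or_ge a 0 with ha0 | ha0
      · filter_upwards [self_mem_nhdsWithin] with x hx using ha0.trans_le (h.kInv_nonneg hx)
      · rw [h.lt_kInv_iff ha0 hy] at ha
        filter_upwards [self_mem_nhdsWithin, mem_nhdsWithin_of_mem_nhds (lt_mem_nhds ha)]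
          with x hx hx' using (h.lt_kInv_iff ha0 hx).2 hx'
    · have hb0 : 0 ≤ b := (h.kInv_nonneg hy).trans hb.le
      rw [gt_iff_lt] at hb
      rw [h.kInv_lt_iff hb0 hy] at hb
      filter_upwards [self_mem_nhdsWithin, mem_nhdsWithin_of_mem_nhds (gt_mem_nhds hb)]
        with x hx hx' using (h.kInv_lt_iff hb0 hx).2 hx'
  strictMono := fun x hx y hy hxy => by
    rw [h.lt_kInv_iff (h.kInv_nonneg hx) hy, h.apply_kInv hx]
    exact hxy
  zero := by
    have := h.kInv_apply le_rfl
    rwa [h.zero] at this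
  unbounded := by
    refine tendsto_atTop.2 fun b => ?_
    filter_upwards [eventually_ge_atTop (γ (max b 0))] with x hx
    have hx0 : 0 ≤ x := (h.nonneg (le_max_right b 0)).trans hx
    exact (le_max_left b 0).trans ((h.le_kInv_iff (le_max_right b 0) hx0).2 hx)

theorem ClassK.comp (hα : ClassK α) (hγ : ClassK γ) : ClassK (fun r => α (γ r)) where
  cont := hα.cont.comp hγ.cont hγ.mapsTo
  strictMono := hα.strictMono.comp hγ.strictMono hγ.mapsTo
  zero := by simp [hα.zero, hγ.zero]

theorem ClassKInf.comp (hα : ClassKInf α) (hγ : ClassKInf γ) : ClassKInf (fun r => α (γ r)) where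
  toClassK := hα.toClassK.comp hγ.toClassK
  unbounded := hα.unbounded.comp hγ.unbounded

theorem ClassKInf.max (hα : ClassKInf α) (hγ : ClassKInf γ) :
    ClassKInf (fun r => max (α r) (γ r)) where
  cont := hα.cont.sup hγ.cont
  strictMono := fun _ hx _ hy hxy => max_lt_max (hα.strictMono hx hy hxy) (hγ.strictMono hx hy hxy)
  zero := by simp [hα.zero, hγ.zero]
  unbounded := tendsto_atTop_mono (fun _ => le_max_left _ _) hα.unbounded

theorem ClassKInf.min (hα : ClassKInf α) (hγ : ClassKInf γ) :
    ClassKInf (fun r => min (α r) (γ r)) where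
  cont := hα.cont.inf hγ.cont
  strictMono := fun _ hx _ hy hxy => min_lt_min (hα.strictMono hx hy hxy) (hγ.strictMono hx hy hxy)
  zero := by simp [hα.zero, hγ.zero]
  unbounded := by
    refine tendsto_atTop.2 fun b => ?_
    filter_upwards [hα.unbounded.eventually_ge_atTop b, hγ.unbounded.eventually_ge_atTop b]
      with x h1 h2 using le_min h1 h2

theorem classKInf_mul_left {c : ℝ} (hc : 0 < c) : ClassKInf (fun r => c * r) where
  cont := by fun_prop
  strictMono := fun _ _ _ _ hxy => mul_lt_mul_of_pos_left hxy hc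
  zero := by simp
  unbounded := tendsto_id.const_mul_atTop hc

theorem classKInf_id_add (hcont : ContinuousOn α (Ici 0)) (hmono : MonotoneOn α (Ici 0))
    (hzero : α 0 = 0) : ClassKInf (fun r => r + α r) where
  cont := continuousOn_id.add hcont
  strictMono := fun _ hx _ hy hxy => add_lt_add_of_lt_of_le hxy (hmono hx hy hxy.le)
  zero := by simp [hzero]
  unbounded := by
    refine tendsto_atTop_mono' _ ?_ tendsto_id
    filter_upwards [eventually_ge_atTop 0] with x hx
    have := hmono self_mem_Ici hx hx
    simp only [id]
    linarith

/-! ### Construction of the rescaling `κ` and of the scaling function `σ`. -/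

theorem contDiffOn_one_of_hasDerivAt {f f' : ℝ → ℝ} {s : Set ℝ} (hs : IsOpen s)
    (hf : ∀ x ∈ s, HasDerivAt f (f' x) x) (hf' : ContinuousOn f' s) : ContDiffOn ℝ 1 f s := by
  have : ContDiffOn ℝ (0 + 1) f s := by
    rw [contDiffOn_succ_iff_deriv_of_isOpen hs]
    refine ⟨fun x hx => (hf x hx).differentiableAt.differentiableWithinAt, by simp, ?_⟩
    rw [contDiffOn_zero]
    exact hf'.congr fun x hx => (hf x hx).deriv
  simpa using this

/-- Every positive rate function `α` admits a rescaling `κ ∈ 𝒦∞` along which decay at rate `α`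
becomes exponential decay. -/
theorem exists_exponential_rescaling (hcont : ContinuousOn α (Ioi 0)) (hpos : ∀ r, 0 < r → 0 < α r) :
    ∃ κ : ℝ → ℝ, ClassKInf κ ∧ ContDiffOn ℝ 1 κ (Ioi 0) ∧ (∀ r, 0 < r → 0 ≤ deriv κ r) ∧
      ∀ r, 0 < r → κ r ≤ deriv κ r * α r := by
  -- The ansatz is `κ = exp ∫₁ g`, so `κ' α = κ α / min(α, s) ≥ κ`. The minimum with `s` gives `g ≥
  -- 1/s`, whence `κ(r) ≤ r` below `1` and `κ(r) ≥ r` above `1`: this forces `κ → 0` at `0` and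
  -- unboundedness.
  set g : ℝ → ℝ := fun s => (min (α s) s)⁻¹ with hg
  have hminpos : ∀ s, 0 < s → 0 < min (α s) s := fun s hs => lt_min (hpos s hs) hs
  have hgcont : ContinuousOn g (Ioi 0) :=
    (hcont.inf continuousOn_id).inv₀ fun s hs => (hminpos s hs).ne'
  have hgpos : ∀ s, 0 < s → 0 < g s := fun s hs => inv_pos.2 (hminpos s hs)
  have hint : ∀ a b, 0 < a → 0 < b → IntervalIntegrable g volume a b := fun a b ha hb =>
    (hgcont.mono fun x hx => (lt_min ha hb).trans_le hx.1).intervalIntegrable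
  set G : ℝ → ℝ := fun r => ∫ s in (1 : ℝ)..r, g s with hG
  have hGd : ∀ r, 0 < r → HasDerivAt G (g r) r := fun r hr =>
    intervalIntegral.integral_hasDerivAt_right (hint 1 r one_pos hr)
      (hgcont.stronglyMeasurableAtFilter isOpen_Ioi r hr) (hgcont.continuousAt (Ioi_mem_nhds hr))
  set κ : ℝ → ℝ := fun r => if r ≤ 0 then 0 else Real.exp (G r) with hκ
  have hκpos : ∀ r, 0 < r → κ r = Real.exp (G r) := fun r hr => if_neg hr.not_ge
  have hκd : ∀ r, 0 < r → HasDerivAt κ (κ r * g r) r := by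
    intro r hr
    rw [hκpos r hr]
    refine (hGd r hr).exp.congr_of_eventuallyEq ?_
    filter_upwards [lt_mem_nhds hr] with x hx using hκpos x hx
  have hκcont : ContinuousOn κ (Ioi 0) := fun r hr => (hκd r hr).continuousAt.continuousWithinAt
  have hcomp : ∀ r, 0 < r → (1 ≤ r → Real.log r ≤ G r) ∧ (r ≤ 1 → G r ≤ Real.log r) := by
    intro r hr
    have hle : ∀ x, 0 < x → x⁻¹ ≤ g x := fun x hx =>
      inv_anti₀ (hminpos x hx) (min_le_right _ _)
    have hinv : ∀ a b : ℝ, 0 < a → 0 < b → IntervalIntegrable (fun x : ℝ => x⁻¹) volume a b :=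
      fun a b ha hb => intervalIntegral.intervalIntegrable_inv
        (fun x hx => ((lt_min ha hb).trans_le hx.1).ne') continuousOn_id
    constructor
    · intro h1
      have := intervalIntegral.integral_mono_on h1 (hinv 1 r one_pos hr) (hint 1 r one_pos hr)
        (fun x hx => hle x (one_pos.trans_le hx.1))
      rwa [integral_inv_of_pos one_pos hr, div_one] at this
    · intro h1
      have := intervalIntegral.integral_mono_on h1 (hinv r 1 hr one_pos) (hint r 1 hr one_pos)
        (fun x hx => hle x (hr.trans_le hx.1))
      rw [integral_inv_of_pos hr one_pos, one_div, Real.log_inv] at this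
      rw [hG]
      simp only
      rw [intervalIntegral.integral_symm]
      linarith
  have hlow : ∀ r, 1 ≤ r → r ≤ κ r := fun r hr => by
    have h0 := one_pos.trans_le hr
    rw [hκpos r h0, ← Real.log_le_iff_le_exp h0]
    exact (hcomp r h0).1 hr
  have hup : ∀ r, 0 < r → r ≤ 1 → κ r ≤ r := fun r h0 hr => by
    rw [hκpos r h0, ← Real.le_log_iff_exp_le h0]
    exact (hcomp r h0).2 hr
  have hκz : κ 0 = 0 := if_pos le_rfl
  have hκnn : ∀ r, 0 ≤ κ r := fun r => by
    simp only [hκ]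
    split_ifs
    exacts [le_rfl, (Real.exp_pos _).le]
  have hκc0 : ContinuousOn κ (Ici 0) := by
    intro r hr
    rcases eq_or_lt_of_le (show 0 ≤ r from hr) with rfl | hr
    · rw [ContinuousWithinAt, hκz]
      have hid : Tendsto (fun x : ℝ => x) (𝓝[Ici 0] 0) (𝓝 0) := tendsto_id.mono_left inf_le_left
      refine tendsto_of_tendsto_of_tendsto_of_le_of_le' tendsto_const_nhds hid
        (Eventually.of_forall hκnn) ?_
      filter_upwards [self_mem_nhdsWithin, mem_nhdsWithin_of_mem_nhds (gt_mem_nhds one_pos)]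
        with x hx hx1
      rcases eq_or_lt_of_le (show 0 ≤ x from hx) with rfl | hx
      · exact hκz.le
      · exact hup x hx hx1.le
    · exact (hκd r hr).continuousAt.continuousWithinAt
  refine ⟨κ, ⟨⟨hκc0, ?_, hκz⟩, ?_⟩, ?_, ?_, ?_⟩
  · refine strictMonoOn_of_deriv_pos (convex_Ici 0) hκc0 fun r hr => ?_
    rw [interior_Ici] at hr
    rw [(hκd r hr).deriv, hκpos r hr]
    exact mul_pos (Real.exp_pos _) (hgpos r hr)
  · refine tendsto_atTop_mono' _ ?_ tendsto_id
    filter_upwards [eventually_ge_atTop 1] with r hr using hlow r hr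
  · exact contDiffOn_one_of_hasDerivAt isOpen_Ioi hκd (hκcont.mul hgcont)
  · intro r hr
    rw [(hκd r hr).deriv]
    exact mul_nonneg (hκnn r) (hgpos r hr).le
  · intro r hr
    rw [(hκd r hr).deriv, mul_assoc]
    refine le_mul_of_one_le_right (hκnn r) ?_
    simp only [hg]
    rw [inv_mul_eq_div, one_le_div (hminpos r hr)]
    exact min_le_left _ _

/-- A strictly increasing continuous function `a` lying below a continuous function `b` can be separated
from `b` by a `C¹` function with positive derivative. -/
theorem exists_deriv_pos_between {a b : ℝ → ℝ} (ha : Continuous a) (hb : Continuous b)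
    (hmono : StrictMono a) (hab : ∀ t, a t < b t) :
    ∃ f f' : ℝ → ℝ, (∀ t, HasDerivAt f (f' t) t) ∧ Continuous f' ∧ (∀ t, 0 < f' t) ∧
      ∀ t, a t < f t ∧ f t < b t := by
  -- The admissible step lengths at `t` form a convex set, and one of them works for all nearby
  -- points, so a continuous selection exists.
  obtain ⟨η, hη⟩ : ∃ η : C(ℝ, ℝ), ∀ t, η t ∈ {h : ℝ | 0 < h ∧ h < 1 ∧ a (t + h) < b t} := by
    refine exists_continuous_forall_mem_convex_of_local_const (fun t => ?_) fun t => ?_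
    · refine OrdConnected.convex ⟨fun x hx y hy z hz => ⟨hx.1.trans_le hz.1, hz.2.trans_lt hy.2.1, ?_⟩⟩
      exact (hmono.monotone (by linarith [hz.2])).trans_lt hy.2.2
    · have h1 : ∀ᶠ h in 𝓝[>] (0 : ℝ), a (t + h) < b t := by
        refine mem_nhdsWithin_of_mem_nhds ?_
        refine ContinuousAt.eventually_lt (f := fun h => a (t + h)) (by fun_prop) (by fun_prop) ?_
        simpa using hab t
      have h2 : ∀ᶠ h in 𝓝[>] (0 : ℝ), h < 1 := mem_nhdsWithin_of_mem_nhds (gt_mem_nhds one_pos)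
      obtain ⟨h, ⟨hh1, hh2⟩, hh3⟩ := ((h1.and h2).and self_mem_nhdsWithin).exists
      refine ⟨h, ?_⟩
      have : ∀ᶠ y in 𝓝 t, a (y + h) < b y :=
        ContinuousAt.eventually_lt (f := fun y => a (y + h)) (by fun_prop) (by fun_prop) hh1
      filter_upwards [this] with y hy using ⟨hh3, hh2, hy⟩
  -- For `r ≥ 0`, `m r` is the minimum of `η` over `[-r, r]`: nonincreasing, continuous, with values
  -- in `(0, 1)`.
  set m : ℝ → ℝ := fun r => sInf ((fun s => η (r * s)) '' Icc (-1) 1) with hm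
  have hne : (Icc (-1 : ℝ) 1).Nonempty := ⟨0, by simp⟩
  have hcomp : ∀ r, IsCompact ((fun s => η (r * s)) '' Icc (-1 : ℝ) 1) := fun r =>
    isCompact_Icc.image (by fun_prop)
  have hmc : Continuous m := isCompact_Icc.continuous_sInf (f := fun r s => η (r * s))
    (by simp only [Function.HasUncurry.uncurry, id]; fun_prop)
  have hmmem : ∀ r, 0 < m r ∧ m r < 1 := fun r => by
    obtain ⟨s, -, hs⟩ := (hcomp r).sInf_mem (hne.image _)
    have h := hη (r * s)
    simp only [hm]
    rw [← hs]
    exact ⟨h.1, h.2.1⟩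
  have hmle : ∀ r s, |s| ≤ r → m r ≤ η s := fun r s hs => by
    refine csInf_le (hcomp r).bddBelow ?_
    rcases (abs_nonneg s |>.trans hs).eq_or_lt with h0 | h0
    · exact ⟨0, by simp, by simp [show s = 0 by rw [← h0] at hs; simpa using hs]⟩
    · refine ⟨s / r, ?_, by simp only; rw [mul_div_cancel₀ _ h0.ne']⟩
      rw [mem_Icc, ← abs_le, abs_div, abs_of_pos h0]
      exact (div_le_one h0).2 hs
  have hmanti : ∀ r s, 0 ≤ r → r ≤ s → m s ≤ m r := fun r s hr hrs => by
    obtain ⟨y, hy, hys⟩ := (hcomp r).sInf_mem (hne.image _)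
    have : m r = η (r * y) := hys.symm
    rw [this]
    refine hmle s _ ?_
    rw [abs_mul, abs_of_nonneg hr]
    calc r * |y| ≤ r * 1 := mul_le_mul_of_nonneg_left (abs_le.2 hy) hr
      _ ≤ s := by linarith
  set w : ℝ → ℝ := fun t => √(1 + t ^ 2) with hw
  have hwpos : ∀ t, 0 < w t := fun t => Real.sqrt_pos.2 (by positivity)
  have hwabs : ∀ t, |t| ≤ w t := fun t => by
    rw [← Real.sqrt_sq_eq_abs]
    exact Real.sqrt_le_sqrt (by linarith)
  have hwd : ∀ t, HasDerivAt w (t / w t) t := fun t => by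
    have := ((hasDerivAt_pow 2 t).const_add 1).sqrt (x := t) (by positivity)
    convert this using 1
    simp only [hw]
    field_simp
    norm_num [mul_comm]
  have hwc : Continuous w := by fun_prop
  -- `η` is replaced by a `C¹` step length. Averaging the nonincreasing `m` over `[w, w + 1]` keeps
  -- `h ≤ m(w) ≤ η`, as `w(t) ≥ |t|`. Since `m` varies by less than `1` and `|w'| ≤ 1`, also `h' >
  -- -1`.
  set h : ℝ → ℝ := fun t => ∫ s in (w t)..(w t + 1), m s with hh
  set h' : ℝ → ℝ := fun t => (m (w t + 1) - m (w t)) * (t / w t) with hh'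
  have hmd : ∀ x, HasDerivAt (fun x => ∫ s in (0 : ℝ)..x, m s) (m x) x := fun x =>
    hmc.integral_hasStrictDerivAt 0 x |>.hasDerivAt
  have hd : ∀ t, HasDerivAt h (h' t) t := fun t => by
    have e : h = fun t => (∫ s in (0 : ℝ)..(w t + 1), m s) - ∫ s in (0 : ℝ)..(w t), m s := by
      funext t
      exact (intervalIntegral.integral_interval_sub_left (hmc.intervalIntegrable _ _)
        (hmc.intervalIntegrable _ _)).symm
    rw [e]
    have h1 := (hmd (w t + 1)).comp t ((hwd t).add_const 1)
    have h2 := (hmd (w t)).comp t (hwd t)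
    have h3 := h1.sub h2
    rwa [← sub_mul] at h3
  have hhpos : ∀ t, 0 < h t := fun t =>
    intervalIntegral.intervalIntegral_pos_of_pos (hmc.intervalIntegrable _ _)
      (fun x => (hmmem x).1) (by linarith)
  have hhle : ∀ t, h t ≤ η t := fun t => by
    have : h t ≤ ∫ s in (w t)..(w t + 1), m (w t) :=
      intervalIntegral.integral_mono_on (by linarith) (hmc.intervalIntegrable _ _)
        intervalIntegrable_const fun x hx => hmanti _ _ (hwpos t).le hx.1
    rw [intervalIntegral.integral_const, add_sub_cancel_left, one_smul] at this
    exact this.trans (hmle _ _ (hwabs t))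
  have hh'gt : ∀ t, -1 < h' t := fun t => by
    have h1 : |t / w t| ≤ 1 := by
      rw [abs_div, abs_of_pos (hwpos t)]
      exact (div_le_one (hwpos t)).2 (hwabs t)
    have h2 : |m (w t + 1) - m (w t)| < 1 := by
      have := hmmem (w t + 1)
      have := hmmem (w t)
      rw [abs_lt]
      constructor <;> linarith
    have h3 : |h' t| < 1 := by
      simp only [hh']
      rw [abs_mul]
      exact (mul_le_of_le_one_right (abs_nonneg _) h1).trans_lt h2
    exact (abs_lt.1 h3).1
  have hhc : Continuous h := continuous_iff_continuousAt.2 fun t => (hd t).continuousAt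
  have hh'c : Continuous h' := by
    simp only [hh']
    exact ((hmc.comp (hwc.add_const 1)).sub (hmc.comp hwc)).mul
      (continuous_id.div hwc fun t => (hwpos t).ne')
  set A : ℝ → ℝ := fun x => ∫ s in (0 : ℝ)..x, a s with hA
  have hAd : ∀ x, HasDerivAt A (a x) x := fun x => (ha.integral_hasStrictDerivAt 0 x).hasDerivAt
  have hAc : Continuous A := continuous_iff_continuousAt.2 fun t => (hAd t).continuousAt
  -- `f(t)` is the mean of `a` over `[t, t + h(t)]`, hence above `a(t)` and below `a(t + h(t)) <
  -- b(t)`.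
  refine ⟨fun t => (A (t + h t) - A t) / h t,
    fun t => ((a (t + h t) * (1 + h' t) - a t) * h t - (A (t + h t) - A t) * h' t) / h t ^ 2,
    fun t => ?_, ?_, fun t => ?_, fun t => ?_⟩
  · exact (((hAd (t + h t)).comp t ((hasDerivAt_id t).add (hd t))).sub (hAd t)).div (hd t)
      (hhpos t).ne'
  · exact Continuous.div (by fun_prop) (by fun_prop) fun t => by have := hhpos t; positivity
  all_goals
    have hp := hhpos t
    obtain ⟨c, hc, hce⟩ := exists_hasDerivAt_eq_slope A a (show t < t + h t by linarith)
      hAc.continuousOn fun x _ => hAd x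
    rw [add_sub_cancel_left] at hce
    have hc1 : a t < a c := hmono hc.1
    have hc2 : a c < a (t + h t) := hmono hc.2
  · have e : A (t + h t) - A t = a c * h t := by rw [hce]; field_simp
    simp only [e]
    refine div_pos ?_ (by positivity)
    -- By the mean value theorem `f(t) = a(c)`, and this numerator equals `(a(c) - a(t)) + (1 +
    -- h')(a(t + h) - a(c))`, a sum of two positive terms.
    have : 0 < (a (t + h t) - a t) + h' t * (a (t + h t) - a c) := by
      nlinarith [hh'gt t, mul_pos (show 0 < 1 + h' t by linarith [hh'gt t]) (sub_pos.2 hc2)]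
    calc 0 < ((a (t + h t) - a t) + h' t * (a (t + h t) - a c)) * h t := mul_pos this hp
      _ = _ := by ring
  · simp only
    rw [← hce]
    exact ⟨hc1, hc2.trans ((hmono.monotone (by linarith [hhle t])).trans_lt (hη t).2.2)⟩

/-- The coordinate `t = log r` turns `(0, ∞)` into the real line, where `exists_deriv_pos_between`
applies. The bounds `γs < σ < γf⁻¹` then give continuity at `0` and unboundedness. -/
theorem exists_scalingFunction {γs γf : ℝ → ℝ} (hγs : ClassKInf γs) (hγf : ClassKInf γf)
    (hsmall : ∀ r, 0 < r → γf (γs r) < r) : ∃ σ : ℝ → ℝ, ScalingFunction γs γf σ := by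
  have hexp : ∀ {γ : ℝ → ℝ}, ClassKInf γ → Continuous fun t => γ (Real.exp t) := fun h =>
    h.cont.comp_continuous Real.continuous_exp fun t => (Real.exp_pos t).le
  obtain ⟨f, f', hd, hc, hpos, hbd⟩ := exists_deriv_pos_between (hexp hγs) (hexp hγf.kInv)
    (fun x y hxy => hγs.lt (Real.exp_pos x).le (Real.exp_lt_exp.2 hxy)) fun t =>
      (hγf.lt_kInv_iff (hγs.nonneg (Real.exp_pos t).le) (Real.exp_pos t).le).2
        (hsmall _ (Real.exp_pos t))
  set σ : ℝ → ℝ := fun r => if r ≤ 0 then 0 else f (Real.log r) with hσ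
  have hσpos : ∀ r, 0 < r → σ r = f (Real.log r) := fun r hr => if_neg hr.not_ge
  have hσd : ∀ r, 0 < r → HasDerivAt σ (f' (Real.log r) * r⁻¹) r := by
    intro r hr
    refine ((hd _).comp r (Real.hasDerivAt_log hr.ne')).congr_of_eventuallyEq ?_
    filter_upwards [lt_mem_nhds hr] with x hx using hσpos x hx
  have hσb : ∀ r, 0 < r → γs r < σ r ∧ σ r < kInv γf r := fun r hr => by
    have := hbd (Real.log r)
    rwa [Real.exp_log hr, ← hσpos r hr] at this
  have hσz : σ 0 = 0 := if_pos le_rfl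
  have hσdp : ∀ r, 0 < r → 0 < deriv σ r := fun r hr => by
    rw [(hσd r hr).deriv]
    exact mul_pos (hpos _) (inv_pos.2 hr)
  have hσc : ContinuousOn σ (Ici 0) := by
    intro r hr
    rcases eq_or_lt_of_le (show 0 ≤ r from hr) with rfl | hr
    · rw [ContinuousWithinAt, hσz]
      have hid : Tendsto (kInv γf) (𝓝[Ici 0] 0) (𝓝 0) := by
        have := hγf.kInv.cont 0 self_mem_Ici
        rwa [ContinuousWithinAt, hγf.kInv.zero] at this
      refine tendsto_of_tendsto_of_tendsto_of_le_of_le' tendsto_const_nhds hid ?_ ?_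
      all_goals
        filter_upwards [self_mem_nhdsWithin] with x hx
        rcases eq_or_lt_of_le (show 0 ≤ x from hx) with rfl | hx
      · exact hσz.ge
      · exact (hγs.nonneg hx.le).trans (hσb x hx).1.le
      · rw [hσz, hγf.kInv.zero]
      · exact (hσb x hx).2.le
    · exact (hσd r hr).continuousAt.continuousWithinAt
  refine ⟨σ, ⟨⟨hσc, ?_, hσz⟩, ?_⟩, ?_, hσdp, fun r hr => (hσb r hr).1, fun r hr => (hσb r hr).2⟩
  · refine strictMonoOn_of_deriv_pos (convex_Ici 0) hσc fun r hr => ?_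
    rw [interior_Ici] at hr
    exact hσdp r hr
  · refine tendsto_atTop_mono' _ ?_ hγs.unbounded
    filter_upwards [eventually_gt_atTop 0] with r hr using (hσb r hr).1.le
  · refine contDiffOn_one_of_hasDerivAt isOpen_Ioi hσd ?_
    exact (hc.comp_continuousOn (Real.continuousOn_log.mono fun x hx => (ne_of_gt hx))).mul
      (continuousOn_inv₀.mono fun x hx => (ne_of_gt hx))

end Comparison

/-! ### The composite Lyapunov function and its decay. -/

section Lyapunov

variable {n m p q : ℕ}

/-- The difference `g - f` has a minimum at the contact point. This replaces any nonsmooth calculus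
for the maximum. -/
theorem fderiv_eq_of_le_of_eq {E : Type*} [NormedAddCommGroup E] [NormedSpace ℝ E] {f g : E → ℝ} {a : E}
    (hf : DifferentiableAt ℝ f a) (hg : DifferentiableAt ℝ g a) (hle : ∀ y, f y ≤ g y)
    (heq : f a = g a) : fderiv ℝ f a = fderiv ℝ g a := by
  have hmin : IsLocalMin (fun y => g y - f y) a := Eventually.of_forall fun y => by
    simp only [heq, sub_self]
    exact sub_nonneg.2 (hle y)
  have := hmin.fderiv_eq_zero
  rw [fderiv_fun_sub hg hf, sub_eq_zero] at this
  exact this.symm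

theorem fderiv_apply_prodMk {E F G : Type*} [NormedAddCommGroup E] [NormedSpace ℝ E]
    [NormedAddCommGroup F] [NormedSpace ℝ F] [NormedAddCommGroup G] [NormedSpace ℝ G] {f : E × F → G}
    {a : E} {b : F} (hf : DifferentiableAt ℝ f (a, b)) (v : E) (w : F) :
    fderiv ℝ f (a, b) (v, w) =
      fderiv ℝ (fun a' => f (a', b)) a v + fderiv ℝ (fun b' => f (a, b')) b w := by
  have h1 := (HasFDerivAt.comp (f := fun a' => (a', b)) a hf.hasFDerivAt (hasFDerivAt_prodMk_left a b)).fderiv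
  have h2 := (HasFDerivAt.comp (f := fun b' => (a, b')) b hf.hasFDerivAt (hasFDerivAt_prodMk_right a b)).fderiv
  simp only [Function.comp_def] at h1 h2
  rw [h1, h2]
  simp [← map_add]

theorem SlowLyapunov.nonneg {gs : Euc n → Euc m → Euc p → Euc n}
    {Vs : Euc n → ℝ} {Vf : Euc m → Euc n → ℝ} {αsl αsu γs χs αs : ℝ → ℝ}
    (h : SlowLyapunov gs Vs Vf αsl αsu γs χs αs) (x : Euc n) : 0 ≤ Vs x :=
  (h.lower_class.nonneg (norm_nonneg x)).trans (h.lower x)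

theorem FastLyapunov.nonneg {gf : Euc m → Euc n → Euc q → Euc m} {φ : Euc n → Euc m}
    {Vs : Euc n → ℝ} {Vf : Euc m → Euc n → ℝ} {αfl αfu χf αf lf1 lf2 : ℝ → ℝ}
    (h : FastLyapunov gf φ Vs Vf αfl αfu χf αf lf1 lf2) (z : Euc m) (x : Euc n) : 0 ≤ Vf z x :=
  (h.lower_class.nonneg (norm_nonneg _)).trans (h.lower z x)

theorem ClassPD.nonneg {α : ℝ → ℝ} (h : ClassPD α) {r : ℝ} (hr : 0 ≤ r) : 0 ≤ α r := by
  rcases hr.eq_or_lt with rfl | hr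
  exacts [h.zero.ge, (h.pos r hr).le]

theorem ScalingFunction.lower_le {γs γf σ : ℝ → ℝ} (h : ScalingFunction γs γf σ) (hγs : ClassKInf γs)
    {r : ℝ} (hr : 0 ≤ r) : γs r ≤ σ r := by
  rcases hr.eq_or_lt with rfl | hr
  exacts [by rw [hγs.zero, h.classKInf.zero], (h.lower r hr).le]

theorem ScalingFunction.le_upper {γs γf σ : ℝ → ℝ} (h : ScalingFunction γs γf σ) (hγf : ClassKInf γf)
    {r : ℝ} (hr : 0 ≤ r) : σ r ≤ kInv γf r := by
  rcases hr.eq_or_lt with rfl | hr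
  exacts [by rw [hγf.kInv.zero, h.classKInf.zero], (h.upper r hr).le]

theorem norm_eucProd_le (y : EucProd n m) : ‖y‖ ≤ ‖y.fst‖ + ‖y.snd‖ := by
  refine (sq_le_sq₀ (norm_nonneg _) (by positivity)).1 ?_
  rw [WithLp.prod_norm_sq_eq_of_L2]
  nlinarith [norm_nonneg y.fst, norm_nonneg y.snd]

theorem maxLyapunov_posDefRadiallyUnbounded {gs : Euc n → Euc m → Euc p → Euc n}
    {gf : Euc m → Euc n → Euc q → Euc m} {φ : Euc n → Euc m}
    {Vs : Euc n → ℝ} {Vf : Euc m → Euc n → ℝ}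
    {αsl αsu γs χs αs αfl αfu χf αf lf1 lf2 : ℝ → ℝ}
    (hslow : SlowLyapunov gs Vs Vf αsl αsu γs χs αs)
    (hfast : FastLyapunov gf φ Vs Vf αfl αfu χf αf lf1 lf2)
    {σ : ℝ → ℝ} (hσ : ClassKInf σ) : PosDefRadiallyUnbounded φ (maxLyapunov Vs Vf σ) := by
  -- The larger of `|x|` and `|z - φ(x)|` is at least half the norm of the pair, whence the argument
  -- `r / 2` in the lower bound.
  have hhalf := classKInf_mul_left (c := 1 / 2) (by norm_num)
  refine ⟨_, _, (hslow.lower_class.min (hσ.comp hfast.lower_class)).comp hhalf,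
    hslow.upper_class.max (hσ.comp hfast.upper_class), fun x z => ?_⟩
  set y : EucProd n m := WithLp.toLp 2 (x, z - φ x) with hy
  have hx : ‖x‖ ≤ ‖y‖ := WithLp.norm_fst_le _ y
  have hz : ‖z - φ x‖ ≤ ‖y‖ := WithLp.norm_snd_le _ y
  have hsum : ‖y‖ ≤ ‖x‖ + ‖z - φ x‖ := norm_eucProd_le y
  constructor
  · rcases le_total ‖x‖ ‖z - φ x‖ with h | h
    · refine (min_le_right _ _).trans (le_trans ?_ (le_max_right _ _))
      refine hσ.mono (hfast.lower_class.nonneg (by positivity)) ?_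
      exact (hfast.lower_class.mono (by positivity) (by linarith)).trans (hfast.lower z x)
    · refine (min_le_left _ _).trans (le_trans ?_ (le_max_left _ _))
      exact (hslow.lower_class.mono (by positivity) (by linarith)).trans (hslow.lower x)
  · refine max_le_max ((hslow.upper x).trans (hslow.upper_class.mono (norm_nonneg _) hx)) ?_
    refine hσ.mono (hfast.nonneg z x) ?_
    exact (hfast.upper z x).trans (hfast.upper_class.mono (norm_nonneg _) hz)

/-- The composite Lyapunov function decays along the active component at a rate that is a continuous
positive function of its value. -/
theorem exists_decay_rate
    {ρs : Euc n → Euc m → Euc p → ℝ} {gs : Euc n → Euc m → Euc p → Euc n}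
    {ρf : Euc m → Euc n → Euc q → ℝ} {gf : Euc m → Euc n → Euc q → Euc m}
    (hρs : ∀ x z d, 0 ≤ ρs x z d) (hρf : ∀ z x w, 0 ≤ ρf z x w)
    {φ : Euc n → Euc m} {Vs : Euc n → ℝ} {Vf : Euc m → Euc n → ℝ}
    {αsl αsu γs χs αs : ℝ → ℝ} (hslow : SlowLyapunov gs Vs Vf αsl αsu γs χs αs)
    {αfl αfu χf αf lf1 lf2 : ℝ → ℝ} (hfast : FastLyapunov gf φ Vs Vf αfl αfu χf αf lf1 lf2)
    {ρsl : ℝ → ℝ} (hρsl : ClassP ρsl)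
    (hslowRate : ∀ x z d, max (γs (Vf z x)) (χs ‖d‖) ≤ Vs x → ρsl (Vs x) ≤ ρs x z d)
    {γf ρsu ρfl : ℝ → ℝ} (hγf : ClassKInf γf) (hρsu : ClassP ρsu) (hρfl : ClassP ρfl)
    (hdominance : ∀ r, 0 < r → ρsu r * (lf1 r + lf2 (kInv γf r)) < ρfl r * αf r)
    (hfastRate : ∀ x z d w,
      max (γf (Vs x)) (max (γf (χs ‖d‖)) (χf ‖w‖)) ≤ Vf z x →
        ρs x z d * ‖gs x z d‖ ≤ ρsu (Vf z x) ∧ ρfl (Vf z x) ≤ ρf z x w)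
    {σ : ℝ → ℝ} (hσ : ScalingFunction γs γf σ) :
    ∃ α : ℝ → ℝ, ContinuousOn α (Ioi 0) ∧ (∀ r, 0 < r → 0 < α r) ∧ ∀ x z d w,
      0 < maxLyapunov Vs Vf σ x z →
      max (χs ‖d‖) (σ (χf ‖w‖)) ≤ maxLyapunov Vs Vf σ x z →
      (maxLyapunov Vs Vf σ x z = Vs x →
        fderiv ℝ Vs x (ρs x z d • gs x z d) ≤ -α (maxLyapunov Vs Vf σ x z)) ∧
      (maxLyapunov Vs Vf σ x z = σ (Vf z x) →
        deriv σ (Vf z x) * fderiv ℝ (fun a : Euc m × Euc n => Vf a.1 a.2) (z, x)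
          (ρf z x w • gf z x w, ρs x z d • gs x z d) ≤ -α (maxLyapunov Vs Vf σ x z)) := by
  -- The margin in the dominance condition: `Vf` decays at least at this rate when the fast part is
  -- active.
  set δ : ℝ → ℝ := fun r => ρfl r * αf r - ρsu r * (lf1 r + lf2 (kInv γf r)) with hδ
  have hδpos : ∀ r, 0 < r → 0 < δ r := fun r hr => sub_pos.2 (hdominance r hr)
  have hδcont : ContinuousOn δ (Ici 0) :=
    (hρfl.cont.mul hfast.decay_class.cont).sub (hρsu.cont.mul (hfast.cross1_class.cont.add
      (hfast.cross2_class.cont.comp hγf.kInv.cont hγf.kInv.mapsTo)))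
  have hσ' : ContinuousOn (deriv σ) (Ioi 0) :=
    hσ.contDiffOn.continuousOn_deriv_of_isOpen isOpen_Ioi le_rfl
  have hK := hσ.classKInf
  have hinv : MapsTo (kInv σ) (Ioi 0) (Ioi 0) := fun r hr => hK.kInv.pos hr
  have hinvc : ContinuousOn (kInv σ) (Ioi 0) := hK.kInv.cont.mono Ioi_subset_Ici_self
  -- The rates of the two cases, both as functions of `V = v`; in the fast case `Vf = σ⁻¹(v)`, and
  -- the chain rule contributes `σ'`.
  refine ⟨fun v => min (ρsl v * αs v) (deriv σ (kInv σ v) * δ (kInv σ v)), ?_, ?_, ?_⟩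
  · exact ((hρsl.cont.mul hslow.decay_class.cont).mono Ioi_subset_Ici_self).inf
      ((hσ'.comp hinvc hinv).mul ((hδcont.mono Ioi_subset_Ici_self).comp hinvc hinv))
  · exact fun r hr => lt_min (mul_pos (hρsl.pos r hr) (hslow.decay_class.pos r hr))
      (mul_pos (hσ.deriv_pos _ (hinv hr)) (hδpos _ (hinv hr)))
  intro x z d w hpos hin
  have hVf := hfast.nonneg z x
  have hVs := hslow.nonneg x
  have hd : χs ‖d‖ ≤ maxLyapunov Vs Vf σ x z := (le_max_left _ _).trans hin
  have hw : σ (χf ‖w‖) ≤ maxLyapunov Vs Vf σ x z := (le_max_right _ _).trans hin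
  constructor
  · intro hV
    have hle : σ (Vf z x) ≤ Vs x := hV ▸ le_max_right _ _
    rw [hV] at hd ⊢
    have hmax : max (γs (Vf z x)) (χs ‖d‖) ≤ Vs x :=
      max_le ((hσ.lower_le hslow.gain_class hVf).trans hle) hd
    rw [map_smul, smul_eq_mul]
    have h1 := hslow.decay x z d hmax
    have h2 := hslowRate x z d hmax
    have h3 := hslow.decay_class.nonneg hVs
    calc ρs x z d * fderiv ℝ Vs x (gs x z d) ≤ ρs x z d * -αs (Vs x) :=
          mul_le_mul_of_nonneg_left h1 (hρs x z d)
      _ ≤ -(ρsl (Vs x) * αs (Vs x)) := by nlinarith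
      _ ≤ _ := neg_le_neg (min_le_left _ _)
  · intro hV
    have hle : Vs x ≤ σ (Vf z x) := hV ▸ le_max_left _ _
    rw [hV] at hd hw hpos ⊢
    have hVfpos : 0 < Vf z x := by
      refine hVf.lt_of_ne fun h => ?_
      rw [← h, hK.zero] at hpos
      exact lt_irrefl _ hpos
    have hup := hσ.le_upper hγf hVf
    have hdn : 0 ≤ χs ‖d‖ := hslow.input_gain_class.nonneg (norm_nonneg d)
    have hw' : χf ‖w‖ ≤ Vf z x :=
      (hK.le_iff (hfast.input_gain_class.nonneg (norm_nonneg w)) hVf).1 hw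
    obtain ⟨h1, h2⟩ := hfastRate x z d w (max_le ((hγf.le_kInv_iff hVs hVf).1 (hle.trans hup))
      (max_le ((hγf.le_kInv_iff hdn hVf).1 (hd.trans hup)) hw'))
    have h3 := hfast.decay z x w hw'
    have h4 := hfast.decay_class.nonneg hVf
    -- Monotonicity of `lf2` is what turns `Vs ≤ γf⁻¹(Vf)` into a bound depending on `Vf` alone.
    have hcross : ‖fderiv ℝ (fun x' => Vf z x') x‖ ≤ lf1 (Vf z x) + lf2 (kInv γf (Vf z x)) :=
      (hfast.cross z x).trans (add_le_add le_rfl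
        (hfast.cross2_mono hVs (hγf.kInv_nonneg hVf) (hle.trans hup)))
    have hslowpart : fderiv ℝ (fun x' => Vf z x') x (ρs x z d • gs x z d) ≤
        ρsu (Vf z x) * (lf1 (Vf z x) + lf2 (kInv γf (Vf z x))) := by
      refine (Real.le_norm_self _).trans ((ContinuousLinearMap.le_opNorm _ _).trans ?_)
      rw [norm_smul, Real.norm_of_nonneg (hρs x z d), mul_comm]
      exact mul_le_mul h1 hcross (norm_nonneg _) ((mul_nonneg (hρs _ _ _) (norm_nonneg _)).trans h1)
    have hfastpart : fderiv ℝ (fun z' => Vf z' x) z (ρf z x w • gf z x w) ≤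
        -(ρfl (Vf z x) * αf (Vf z x)) := by
      rw [map_smul, smul_eq_mul]
      calc ρf z x w * fderiv ℝ (fun z' => Vf z' x) z (gf z x w) ≤ ρf z x w * -αf (Vf z x) :=
            mul_le_mul_of_nonneg_left h3 (hρf z x w)
        _ ≤ _ := by nlinarith
    have htotal : fderiv ℝ (fun a : Euc m × Euc n => Vf a.1 a.2) (z, x)
        (ρf z x w • gf z x w, ρs x z d • gs x z d) ≤ -δ (Vf z x) := by
      rw [fderiv_apply_prodMk (hfast.contDiff.differentiable (by simp) _)]
      simp only [hδ]
      linarith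
    calc _ ≤ deriv σ (Vf z x) * -δ (Vf z x) :=
          mul_le_mul_of_nonneg_left htotal (hσ.deriv_pos _ hVfpos).le
      _ = -(deriv σ (kInv σ (σ (Vf z x))) * δ (kInv σ (σ (Vf z x)))) := by
          rw [hK.kInv_apply hVf]
          ring
      _ ≤ _ := neg_le_neg (min_le_right _ _)

theorem ScalingFunction.hasDerivAt {γs γf σ : ℝ → ℝ} (h : ScalingFunction γs γf σ) {r : ℝ}
    (hr : 0 < r) : HasDerivAt σ (deriv σ r) r :=
  (differentiableAt_of_deriv_ne_zero (h.deriv_pos r hr).ne').hasDerivAt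

/-- A decay rate of the active components yields a decay rate of class `𝒫𝒟` of the composite
Lyapunov function wherever it is differentiable. -/
theorem exists_classPD_decay {Vs : Euc n → ℝ} {Vf : Euc m → Euc n → ℝ} {γs γf σ α : ℝ → ℝ}
    (hVs : ContDiff ℝ 1 Vs) (hVf : ContDiff ℝ 1 (fun a : Euc m × Euc n => Vf a.1 a.2))
    (hVs0 : ∀ x, 0 ≤ Vs x) (hVf0 : ∀ z x, 0 ≤ Vf z x) (hσ : ScalingFunction γs γf σ)
    (hcont : ContinuousOn α (Ioi 0)) (hpos : ∀ r, 0 < r → 0 < α r) :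
    ∃ α' : ℝ → ℝ, ClassPD α' ∧ ∀ x z v w,
      DifferentiableAt ℝ (fun a : Euc n × Euc m => maxLyapunov Vs Vf σ a.1 a.2) (x, z) →
      (0 < maxLyapunov Vs Vf σ x z →
        (maxLyapunov Vs Vf σ x z = Vs x → fderiv ℝ Vs x v ≤ -α (maxLyapunov Vs Vf σ x z)) ∧
        (maxLyapunov Vs Vf σ x z = σ (Vf z x) →
          deriv σ (Vf z x) * fderiv ℝ (fun a : Euc m × Euc n => Vf a.1 a.2) (z, x) (w, v) ≤
            -α (maxLyapunov Vs Vf σ x z))) →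
      fderiv ℝ (fun x' => maxLyapunov Vs Vf σ x' z) x v +
        fderiv ℝ (fun z' => maxLyapunov Vs Vf σ x z') z w ≤ -α' (maxLyapunov Vs Vf σ x z) := by
  have hV0 : ∀ x z, 0 ≤ maxLyapunov Vs Vf σ x z := fun x z => (hVs0 x).trans (le_max_left _ _)
  -- `α` is controlled only on `(0, ∞)`; the minimum with `r` makes the rate continuous at `0` with
  -- value `0`.
  set α' : ℝ → ℝ := fun r => if r ≤ 0 then 0 else min r (α r) with hα'
  have hα'pos : ∀ r, 0 < r → α' r = min r (α r) := fun r hr => if_neg hr.not_ge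
  have hα'0 : α' 0 = 0 := if_pos le_rfl
  refine ⟨α', ⟨?_, fun r hr => ?_, hα'0⟩, ?_⟩
  · intro r hr
    rcases eq_or_lt_of_le (show 0 ≤ r from hr) with rfl | hr
    · rw [ContinuousWithinAt, hα'0]
      have hid : Tendsto (fun x : ℝ => x) (𝓝[Ici 0] 0) (𝓝 0) := tendsto_id.mono_left inf_le_left
      refine tendsto_of_tendsto_of_tendsto_of_le_of_le' tendsto_const_nhds hid ?_ ?_
      all_goals
        filter_upwards [self_mem_nhdsWithin] with x hx
        rcases eq_or_lt_of_le (show 0 ≤ x from hx) with rfl | hx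
        · simp [hα'0]
      · rw [hα'pos x hx]
        exact le_min hx.le (hpos x hx).le
      · rw [hα'pos x hx]
        exact min_le_left _ _
    · have h1 : ContinuousAt (fun r => min r (α r)) r :=
        continuousAt_id.inf (hcont.continuousAt (Ioi_mem_nhds hr))
      refine (h1.congr ?_).continuousWithinAt
      filter_upwards [lt_mem_nhds hr] with x hx using (hα'pos x hx).symm
  · rw [hα'pos r hr]
    exact lt_min hr (hpos r hr)
  intro x z v w hdiff hdec
  rw [← fderiv_apply_prodMk (f := fun a : Euc n × Euc m => maxLyapunov Vs Vf σ a.1 a.2) hdiff]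
  rcases (hV0 x z).eq_or_lt with h0 | h0
  -- Where `V = 0` the point is a global minimum, so the derivative vanishes and nothing is needed
  -- from the dynamics.
  · have hmin : IsLocalMin (fun a : Euc n × Euc m => maxLyapunov Vs Vf σ a.1 a.2) (x, z) :=
      Eventually.of_forall fun y => by simpa only [← h0] using hV0 y.1 y.2
    rw [hmin.fderiv_eq_zero, ← h0, hα'0]
    simp
  · have hle : -α (maxLyapunov Vs Vf σ x z) ≤ -α' (maxLyapunov Vs Vf σ x z) := by
      rw [hα'pos _ h0]
      exact neg_le_neg (min_le_right _ _)
    refine le_trans ?_ hle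
    obtain ⟨h1, h2⟩ := hdec h0
    rcases max_choice (Vs x) (σ (Vf z x)) with h | h
    · have hd : HasFDerivAt (fun a : Euc n × Euc m => Vs a.1)
          ((fderiv ℝ Vs x).comp (ContinuousLinearMap.fst ℝ (Euc n) (Euc m))) (x, z) :=
        (hVs.differentiable (by simp) x).hasFDerivAt.comp (x, z) hasFDerivAt_fst
      rw [← fderiv_eq_of_le_of_eq hd.differentiableAt hdiff (fun y => le_max_left _ _) h.symm, hd.fderiv]
      exact h1 h
    · have hVfpos : 0 < Vf z x := by
        refine (hVf0 z x).lt_of_ne fun h' => ?_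
        rw [maxLyapunov, h, ← h', hσ.classKInf.zero] at h0
        exact lt_irrefl _ h0
      have hd : HasFDerivAt (fun a : Euc n × Euc m => σ (Vf a.2 a.1))
          (deriv σ (Vf z x) • (fderiv ℝ (fun a : Euc m × Euc n => Vf a.1 a.2) (z, x)).comp
            ((ContinuousLinearMap.snd ℝ (Euc n) (Euc m)).prod
              (ContinuousLinearMap.fst ℝ (Euc n) (Euc m)))) (x, z) := by
        refine HasDerivAt.comp_hasFDerivAt (h₂ := σ) (x, z) (hσ.hasDerivAt hVfpos) ?_
        exact HasFDerivAt.comp (g := fun a : Euc m × Euc n => Vf a.1 a.2)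
          (f := fun a : Euc n × Euc m => (a.2, a.1)) (x, z)
          (hVf.differentiable (by simp) (z, x)).hasFDerivAt
          (hasFDerivAt_snd.prodMk hasFDerivAt_fst)
      rw [← fderiv_eq_of_le_of_eq hd.differentiableAt hdiff (fun y => le_max_right _ _) h.symm, hd.fderiv]
      exact h2 h

end Lyapunov

/-! ### Uniform bounds and measurability for regular right-hand sides. -/

section Regular

variable {S U Y : Type*} [NormedAddCommGroup S] [NormedAddCommGroup U] [NormedAddCommGroup Y]
  [MeasurableSpace U] [MeasurableSpace Y] {f : S → U → Y}

/-- Viewed as a map of the state into bounded functions of the input with the supremum norm, `f` is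
locally Lipschitz, so compactness gives constants uniform in `u`. -/
theorem RegularRHS.exists_bound_lipschitz (h : RegularRHS f) {K : Set S} (hK : IsCompact K) (R : ℝ) :
    ∃ B L : ℝ, 0 ≤ B ∧ 0 ≤ L ∧ ∀ u : U, ‖u‖ ≤ R → (∀ x ∈ K, ‖f x u‖ ≤ B) ∧
      ∀ x ∈ K, ∀ y ∈ K, ‖f x u - f y u‖ ≤ L * ‖x - y‖ := by
  let F : S → lp (fun _ : {u : U // ‖u‖ ≤ R} => Y) ⊤ := fun x => ⟨fun u => f x u, by
    obtain ⟨B, hB⟩ := h.bounded x R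
    refine memℓp_infty ⟨B, ?_⟩
    rintro _ ⟨u, rfl⟩
    exact hB u u.2⟩
  have hF : LocallyLipschitz F := by
    intro x₀
    obtain ⟨δ, hδ, K, hK⟩ := h.lipschitz x₀ R
    refine ⟨K.toNNReal, Metric.ball x₀ δ, Metric.ball_mem_nhds _ hδ, ?_⟩
    refine LipschitzOnWith.of_dist_le_mul fun x hx y hy => ?_
    rw [dist_eq_norm, dist_eq_norm]
    refine lp.norm_le_of_forall_le (by positivity) fun u => ?_
    refine (hK u u.2 x hx y hy).trans ?_
    exact mul_le_mul_of_nonneg_right (Real.le_coe_toNNReal K) (norm_nonneg _)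
  obtain ⟨L, hL⟩ := hF.locallyLipschitzOn.exists_lipschitzOnWith_of_compact hK
  obtain ⟨B, hB⟩ := hK.exists_bound_of_continuousOn hF.continuous.continuousOn
  refine ⟨max B 0, L, le_max_right _ _, L.2, fun u hu => ⟨fun x hx => ?_, fun x hx y hy => ?_⟩⟩
  · exact (lp.norm_apply_le_norm ENNReal.top_ne_zero (F x) ⟨u, hu⟩).trans
      ((hB x hx).trans (le_max_left _ _))
  · have := hL.dist_le_mul x hx y hy
    rw [dist_eq_norm, dist_eq_norm] at this
    exact (lp.norm_apply_le_norm ENNReal.top_ne_zero (F x - F y) ⟨u, hu⟩).trans this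

theorem RegularRHS.continuous (h : RegularRHS f) (u : U) : Continuous fun x => f x u := by
  have : LocallyLipschitz fun x => f x u := by
    intro x₀
    obtain ⟨δ, hδ, K, hK⟩ := h.lipschitz x₀ ‖u‖
    refine ⟨K.toNNReal, Metric.ball x₀ δ, Metric.ball_mem_nhds _ hδ, ?_⟩
    refine LipschitzOnWith.of_dist_le_mul fun x hx y hy => ?_
    rw [dist_eq_norm, dist_eq_norm]
    refine (hK u le_rfl x hx y hy).trans ?_
    exact mul_le_mul_of_nonneg_right (Real.le_coe_toNNReal K) (norm_nonneg _)
  exact this.continuous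

/-- Continuity in the state and measurability in the input make `f` jointly measurable. -/
theorem RegularRHS.aestronglyMeasurable_comp [MeasurableSpace S] [BorelSpace S]
    [SecondCountableTopology S] [BorelSpace U] [BorelSpace Y] [SecondCountableTopology Y]
    (h : RegularRHS f) {T : Type*} [MeasurableSpace T] {μ : Measure T} {ξ : T → S} {u : T → U}
    (hξ : AEMeasurable ξ μ) (hu : AEMeasurable u μ) :
    AEStronglyMeasurable (fun s => f (ξ s) (u s)) μ := by
  have : Measurable (Function.uncurry f) :=
    measurable_uncurry_of_continuous_of_measurable h.continuous h.measurable
  exact (this.comp_aemeasurable (hξ.prodMk hu)).aestronglyMeasurable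

end Regular

/-! ### Picard iteration for Carathéodory equations. -/

section Existence

variable {X : Type*} [NormedAddCommGroup X] [NormedSpace ℝ X]

theorem IsSolutionOn.mono {U : Type*} {f : X → U → X} {u : ℝ → U} {T T' : ℝ} {ξ : ℝ → X}
    (h : IsSolutionOn f u T ξ) (hT : T' ≤ T) : IsSolutionOn f u T' ξ :=
  fun t ht => h t ⟨ht.1, ht.2.trans hT⟩

theorem IsSolutionOn.continuousOn {U : Type*} {f : X → U → X} {u : ℝ → U} {T : ℝ}
    {ξ : ℝ → X} (h : IsSolutionOn f u T ξ) : ContinuousOn ξ (Icc 0 T) := by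
  rcases lt_or_ge T 0 with hT | hT
  · simp [Icc_eq_empty_of_lt hT]
  have h1 := intervalIntegral.continuousOn_primitive_interval'
    (h T (right_mem_Icc.2 hT)).1 left_mem_uIcc
  rw [uIcc_of_le hT] at h1
  exact (continuousOn_const.add h1).congr fun t ht => (h t ht).2

variable [CompleteSpace X]

/-- Existence of global Carathéodory solutions for a right-hand side that is bounded and globally
Lipschitz in the state, locally uniformly in time. -/
theorem exists_isSolutionOn_of_lipschitz {G : ℝ → X → X}
    (hmeas : ∀ ξ : ℝ → X, Continuous ξ → AEStronglyMeasurable (fun s => G s (ξ s)) volume)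
    (hG : ∀ T : ℝ, ∃ B L : ℝ, ∀ᵐ s, s ≤ T → (∀ x, ‖G s x‖ ≤ B) ∧
      ∀ x y, ‖G s x - G s y‖ ≤ L * ‖x - y‖) (x₀ : X) :
    ∃ ξ : ℝ → X, ξ 0 = x₀ ∧ ∀ T, IsSolutionOn (fun x s => G s x) (fun s => s) T ξ := by
  have hint : ∀ ξ : ℝ → X, Continuous ξ → ∀ a b,
      IntervalIntegrable (fun s => G s (ξ s)) volume a b := by
    intro ξ hξ a b
    obtain ⟨B, L, h⟩ := hG (max a b)
    refine (intervalIntegrable_const (c := B)).mono_fun (hmeas ξ hξ).restrict ?_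
    rw [EventuallyLE, ae_restrict_iff' measurableSet_uIoc]
    filter_upwards [h] with s hs hsI
    exact ((hs hsI.2).1 _).trans (le_abs_self B)
  let ξ : ℕ → ℝ → X := fun k => Nat.rec (fun _ => x₀) (fun _ η t => x₀ + ∫ s in (0 : ℝ)..t, G s (η s)) k
  have hξ0 : ∀ t, ξ 0 t = x₀ := fun _ => rfl
  have hξs : ∀ k t, ξ (k + 1) t = x₀ + ∫ s in (0 : ℝ)..t, G s (ξ k s) := fun _ _ => rfl
  have hξc : ∀ k, Continuous (ξ k) := by
    intro k
    induction k with
    | zero => exact continuous_const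
    | succ k ih => exact continuous_const.add (intervalIntegral.continuous_primitive (hint _ ih) 0)
  -- The factorial makes the increments summable on every interval `[0, T]`, so no contraction on
  -- short intervals and no gluing is needed.
  have hstep : ∀ T B L : ℝ, (∀ᵐ s, s ≤ T → (∀ x, ‖G s x‖ ≤ B) ∧
      ∀ x y, ‖G s x - G s y‖ ≤ L * ‖x - y‖) → 0 ≤ L → ∀ k, ∀ t ∈ Icc 0 T,
      ‖ξ (k + 1) t - ξ k t‖ ≤ B * L ^ k * t ^ (k + 1) / (k + 1).factorial := by
    intro T B L h hL k
    induction k with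
    | zero =>
      intro t ht
      rw [hξs, hξ0, add_sub_cancel_left]
      have := intervalIntegral.norm_integral_le_of_norm_le (f := fun s => G s (ξ 0 s)) ht.1 (g := fun _ => B)
        (by filter_upwards [h] with s hs hsI using (hs (hsI.2.trans ht.2)).1 _)
        intervalIntegrable_const
      refine this.trans (le_of_eq ?_)
      simp [mul_comm]
    | succ k ih =>
      intro t ht
      rw [hξs (k + 1), hξs k, add_sub_add_left_eq_sub,
        ← intervalIntegral.integral_sub (hint _ (hξc (k + 1)) 0 t) (hint _ (hξc k) 0 t)]
      have := intervalIntegral.norm_integral_le_of_norm_le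
        (f := fun s => G s (ξ (k + 1) s) - G s (ξ k s)) ht.1
        (g := fun s => B * L ^ (k + 1) / (k + 1).factorial * s ^ (k + 1)) (by
          filter_upwards [h] with s hs hsI
          have hsT := hsI.2.trans ht.2
          refine ((hs hsT).2 _ _).trans ((mul_le_mul_of_nonneg_left (ih s ⟨hsI.1.le, hsT⟩) hL).trans
            (le_of_eq ?_))
          ring)
        (Continuous.intervalIntegrable (by fun_prop) _ _)
      refine this.trans (le_of_eq ?_)
      rw [intervalIntegral.integral_const_mul, integral_pow, Nat.factorial_succ (k + 1)]
      push_cast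
      field_simp
      simp
  have hlim : ∀ t, ∃ y, 0 ≤ t → Tendsto (fun k => ξ k t) atTop (𝓝 y) := by
    intro t
    by_cases ht : 0 ≤ t
    · obtain ⟨B, L, h⟩ := hG t
      have hB : 0 ≤ |B| := abs_nonneg B
      have h' : ∀ᵐ s, s ≤ t → (∀ x, ‖G s x‖ ≤ |B|) ∧ ∀ x y, ‖G s x - G s y‖ ≤ |L| * ‖x - y‖ := by
        filter_upwards [h] with s hs hst
        refine ⟨fun x => ((hs hst).1 x).trans (le_abs_self B), fun x y => ((hs hst).2 x y).trans ?_⟩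
        exact mul_le_mul_of_nonneg_right (le_abs_self L) (norm_nonneg _)
      have hc : CauchySeq fun k => ξ k t := by
        refine cauchySeq_of_dist_le_of_summable (fun k => |B| * t * ((|L| * t) ^ k / k.factorial))
          (fun k => ?_) ((Real.summable_pow_div_factorial _).mul_left _)
        rw [dist_comm, dist_eq_norm]
        refine (hstep t |B| |L| h' (abs_nonneg L) k t ⟨ht, le_rfl⟩).trans ?_
        have hk : (0 : ℝ) < k.factorial := by positivity
        have hk' : (k.factorial : ℝ) ≤ (k + 1).factorial := by
          exact_mod_cast Nat.factorial_le (Nat.le_succ k)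
        calc |B| * |L| ^ k * t ^ (k + 1) / (k + 1).factorial
            ≤ |B| * |L| ^ k * t ^ (k + 1) / k.factorial :=
              div_le_div_of_nonneg_left (by positivity) hk hk'
          _ = _ := by rw [mul_pow, pow_succ]; ring
      obtain ⟨y, hy⟩ := cauchySeq_tendsto_of_complete hc
      exact ⟨y, fun _ => hy⟩
    · exact ⟨x₀, fun h => absurd h ht⟩
  choose η hη using hlim
  have hmain : ∀ t, 0 ≤ t → IntervalIntegrable (fun s => G s (η s)) volume 0 t ∧
      η t = x₀ + ∫ s in (0 : ℝ)..t, G s (η s) := by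
    intro t ht
    obtain ⟨B, L, h⟩ := hG t
    -- The limit is known only pointwise, which suffices: the uniform bound `B` allows dominated
    -- convergence in the integral equation, and measurability passes to the limit.
    have hconv : ∀ᵐ s, s ∈ uIoc 0 t → Tendsto (fun k => G s (ξ k s)) atTop (𝓝 (G s (η s))) := by
      filter_upwards [h] with s hs hsI
      rw [uIoc_of_le ht] at hsI
      have h1 : Tendsto (fun k => L * ‖ξ k s - η s‖) atTop (𝓝 0) := by
        have := ((hη s hsI.1.le).sub_const (η s)).norm.const_mul L
        simpa using this
      rw [tendsto_iff_norm_sub_tendsto_zero]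
      exact squeeze_zero (fun _ => norm_nonneg _) (fun k => (hs hsI.2).2 _ _) h1
    have hbd : ∀ᶠ k in atTop, ∀ᵐ s, s ∈ uIoc 0 t → ‖G s (ξ k s)‖ ≤ B := Eventually.of_forall fun k => by
      filter_upwards [h] with s hs hsI
      rw [uIoc_of_le ht] at hsI
      exact (hs hsI.2).1 _
    have htend := intervalIntegral.tendsto_integral_filter_of_dominated_convergence (fun _ => B)
      (Eventually.of_forall fun k => (hmeas _ (hξc k)).restrict) hbd intervalIntegrable_const hconv
    constructor
    · refine (intervalIntegrable_const (c := B)).mono_fun ?_ ?_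
      · refine aestronglyMeasurable_of_tendsto_ae atTop (fun k => (hmeas _ (hξc k)).restrict) ?_
        rwa [ae_restrict_iff' measurableSet_uIoc]
      · rw [EventuallyLE, ae_restrict_iff' measurableSet_uIoc]
        filter_upwards [h] with s hs hsI
        rw [uIoc_of_le ht] at hsI
        exact ((hs hsI.2).1 _).trans (le_abs_self B)
    · refine tendsto_nhds_unique ((hη t ht).comp (tendsto_add_atTop_nat 1)) ?_
      simp only [Function.comp_def, hξs]
      exact htend.const_add x₀
  have h0 : η 0 = x₀ := by simpa using (hmain 0 le_rfl).2
  refine ⟨η, h0, fun T t ht => ?_⟩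
  rw [h0]
  exact hmain t ht.1

end Existence

/-! ### Cutoffs and global solutions from a priori bounds. -/

section Cutoff

variable {X Y : Type*} [NormedAddCommGroup X] [NormedAddCommGroup Y] [NormedSpace ℝ Y]

/-- A Lipschitz cutoff function, equal to `1` on the ball of radius `M + 1` and vanishing outside
the ball of radius `M + 2`. -/
noncomputable def ballCutoff (M : ℝ) (x : X) : ℝ := max 0 (min 1 (M + 2 - ‖x‖))

theorem ballCutoff_nonneg (M : ℝ) (x : X) : 0 ≤ ballCutoff M x := le_max_left _ _

theorem ballCutoff_le_one (M : ℝ) (x : X) : ballCutoff M x ≤ 1 :=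
  max_le zero_le_one (min_le_left _ _)

theorem ballCutoff_eq_one {M : ℝ} {x : X} (hx : ‖x‖ ≤ M + 1) : ballCutoff M x = 1 := by
  rw [ballCutoff, min_eq_left (by linarith), max_eq_right zero_le_one]

theorem ballCutoff_eq_zero {M : ℝ} {x : X} (hx : M + 2 < ‖x‖) : ballCutoff M x = 0 :=
  max_eq_left ((min_le_right _ _).trans (by linarith))

theorem abs_ballCutoff_sub_le (M : ℝ) (x y : X) : |ballCutoff M x - ballCutoff M y| ≤ ‖x - y‖ := by
  have h : |(M + 2 - ‖x‖) - (M + 2 - ‖y‖)| ≤ ‖x - y‖ := by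
    rw [sub_sub_sub_cancel_left, norm_sub_rev]
    exact abs_norm_sub_norm_le y x
  refine (abs_max_sub_max_le_max _ _ _ _).trans (max_le (by simp) ?_)
  exact (abs_min_sub_min_le_max _ _ _ _).trans (max_le (by simp) h)

theorem norm_ballCutoff_smul_le {M B : ℝ} {g : X → Y} (hB0 : 0 ≤ B)
    (hB : ∀ x ∈ Metric.closedBall (0 : X) (M + 2), ‖g x‖ ≤ B) (x : X) :
    ‖ballCutoff M x • g x‖ ≤ B := by
  by_cases hx : ‖x‖ ≤ M + 2
  · rw [norm_smul, Real.norm_of_nonneg (ballCutoff_nonneg M x)]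
    have := hB x (by simpa using hx)
    nlinarith [norm_nonneg (g x), ballCutoff_le_one M x]
  · rw [ballCutoff_eq_zero (not_le.1 hx)]
    simpa using hB0

theorem norm_ballCutoff_smul_sub_le {M B L : ℝ} {g : X → Y} (hB0 : 0 ≤ B) (hL0 : 0 ≤ L)
    (hB : ∀ x ∈ Metric.closedBall (0 : X) (M + 2), ‖g x‖ ≤ B)
    (hL : ∀ x ∈ Metric.closedBall (0 : X) (M + 2), ∀ y ∈ Metric.closedBall (0 : X) (M + 2),
      ‖g x - g y‖ ≤ L * ‖x - y‖) (x y : X) :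
    ‖ballCutoff M x • g x - ballCutoff M y • g y‖ ≤ (B + L) * ‖x - y‖ := by
  wlog hx : ‖x‖ ≤ M + 2 generalizing x y
  · by_cases hy : ‖y‖ ≤ M + 2
    · rw [norm_sub_rev, norm_sub_rev x y]
      exact this y x hy
    · rw [ballCutoff_eq_zero (not_le.1 hx), ballCutoff_eq_zero (not_le.1 hy)]
      simp only [zero_smul, sub_zero, norm_zero]
      positivity
  have hgx := hB x (by simpa using hx)
  have hψ := abs_ballCutoff_sub_le M x y
  have h1 : ‖(ballCutoff M x - ballCutoff M y) • g x‖ ≤ B * ‖x - y‖ := by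
    rw [norm_smul, Real.norm_eq_abs, mul_comm]
    exact mul_le_mul hgx hψ (abs_nonneg _) hB0
  have h2 : ‖ballCutoff M y • (g x - g y)‖ ≤ L * ‖x - y‖ := by
    by_cases hy : ‖y‖ ≤ M + 2
    · rw [norm_smul, Real.norm_of_nonneg (ballCutoff_nonneg M y)]
      have := hL x (by simpa using hx) y (by simpa using hy)
      exact (mul_le_of_le_one_left (norm_nonneg _) (ballCutoff_le_one M y)).trans this
    · rw [ballCutoff_eq_zero (not_le.1 hy), zero_smul, norm_zero]
      positivity
  calc ‖ballCutoff M x • g x - ballCutoff M y • g y‖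
      = ‖(ballCutoff M x - ballCutoff M y) • g x + ballCutoff M y • (g x - g y)‖ := by
        rw [sub_smul, smul_sub]; congr 1; abel
    _ ≤ _ := (norm_add_le _ _).trans (by linarith)

end Cutoff

section GlobalExistence

variable {X U : Type*} [NormedAddCommGroup X] [NormedSpace ℝ X] [FiniteDimensional ℝ X]
  [MeasurableSpace X] [BorelSpace X] [NormedAddCommGroup U] [MeasurableSpace U] [BorelSpace U]

/-- A regular system whose solutions satisfy a priori bounds has global solutions. -/
theorem RegularRHS.exists_global_solution {f : X → U → X} (hf : RegularRHS f) {u : ℝ → U}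
    (hu : IsInput u) (x₀ : X)
    (hbound : ∀ T : ℝ, ∃ M : ℝ, ∀ T' ≤ T, ∀ ξ : ℝ → X, ξ 0 = x₀ → IsSolutionOn f u T' ξ →
      ∀ t ∈ Icc 0 T', ‖ξ t‖ ≤ M) :
    ∃ ξ : ℝ → X, ξ 0 = x₀ ∧ ∀ T, 0 ≤ T → IsSolutionOn f u T ξ := by
  have : SecondCountableTopology X := secondCountable_of_proper
  have hcomplete : CompleteSpace X := FiniteDimensional.complete ℝ X
  choose M hM using fun k : ℕ => hbound (k + 1)
  -- The cutoff radius follows the bound valid up to time `⌊s⌋ + 1`, so a single globally Lipschitz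
  -- equation serves all times.
  set G : ℝ → X → X := fun s x => if 0 ≤ s then ballCutoff (M ⌊s⌋₊) x • f x (u s) else 0 with hG
  have hmeas : ∀ ξ : ℝ → X, Continuous ξ → AEStronglyMeasurable (fun s => G s (ξ s)) volume := by
    intro ξ hξ
    have e : (fun s => G s (ξ s)) =
        indicator (Ici 0) fun s => ballCutoff (M ⌊s⌋₊) (ξ s) • f (ξ s) (u s) := by
      funext s
      simp [hG, indicator_apply]
    rw [e, aestronglyMeasurable_indicator_iff measurableSet_Ici]
    refine AEStronglyMeasurable.smul ?_ (hf.aestronglyMeasurable_comp hξ.aemeasurable hu.1.aemeasurable)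
    refine Measurable.aestronglyMeasurable ?_
    have h1 : Measurable fun s : ℝ => M ⌊s⌋₊ := (measurable_from_nat (f := M)).comp Nat.measurable_floor
    exact measurable_const.max (measurable_const.min ((h1.add_const 2).sub hξ.norm.measurable))
  have hlip : ∀ T : ℝ, ∃ B L : ℝ, ∀ᵐ s, s ≤ T → (∀ x, ‖G s x‖ ≤ B) ∧
      ∀ x y, ‖G s x - G s y‖ ≤ L * ‖x - y‖ := by
    intro T
    obtain ⟨c, hc⟩ := hu.2 T
    choose B L hB hL hBL using fun k : ℕ =>
      hf.exists_bound_lipschitz (isCompact_closedBall (0 : X) (M k + 2)) c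
    refine ⟨∑ k ∈ Finset.range (⌊T⌋₊ + 1), B k, ∑ k ∈ Finset.range (⌊T⌋₊ + 1), (B k + L k), ?_⟩
    rw [ae_restrict_iff' measurableSet_Icc] at hc
    filter_upwards [hc] with s hs hsT
    by_cases h0 : 0 ≤ s
    · have hk : ⌊s⌋₊ ∈ Finset.range (⌊T⌋₊ + 1) :=
        Finset.mem_range.2 (Nat.lt_succ_of_le (Nat.floor_mono hsT))
      obtain ⟨h1, h2⟩ := hBL ⌊s⌋₊ (u s) (hs ⟨h0, hsT⟩)
      simp only [hG, if_pos h0]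
      refine ⟨fun x => (norm_ballCutoff_smul_le (hB _) h1 x).trans
        (Finset.single_le_sum (fun k _ => hB k) hk), fun x y => ?_⟩
      refine (norm_ballCutoff_smul_sub_le (hB _) (hL _) h1 h2 x y).trans ?_
      exact mul_le_mul_of_nonneg_right
        (Finset.single_le_sum (f := fun k => B k + L k) (fun k _ => add_nonneg (hB k) (hL k)) hk)
        (norm_nonneg _)
    · simp only [hG, if_neg h0, norm_zero, sub_zero]
      exact ⟨fun _ => Finset.sum_nonneg fun k _ => hB k, fun x y =>
        mul_nonneg (Finset.sum_nonneg fun k _ => add_nonneg (hB k) (hL k)) (norm_nonneg _)⟩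
  obtain ⟨ξ, hξ0, hξ⟩ := exists_isSolutionOn_of_lipschitz hmeas hlip x₀
  refine ⟨ξ, hξ0, fun T hT => ?_⟩
  -- While `ξ` stays where the cutoff is `1`, it solves the original equation; the endpoint `t` is a
  -- null set and may be omitted.
  have hkey : ∀ t, (∀ s ∈ Ico 0 t, ‖ξ s‖ ≤ M ⌊s⌋₊ + 1) → IsSolutionOn f u t ξ := by
    intro t h r hr
    have hae : ∀ᵐ s, s ∈ uIoc 0 r → G s (ξ s) = f (ξ s) (u s) := by
      have hne : ∀ᵐ s : ℝ, s ≠ r := by simp [ae_iff, measure_singleton]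
      filter_upwards [hne] with s hs hsI
      rw [uIoc_of_le hr.1] at hsI
      have hst : s < t := (lt_of_le_of_ne hsI.2 hs).trans_le hr.2
      simp only [hG, if_pos hsI.1.le, ballCutoff_eq_one (h s ⟨hsI.1.le, hst⟩), one_smul]
    obtain ⟨h1, h2⟩ := hξ r r ⟨hr.1, le_rfl⟩
    refine ⟨h1.congr_ae ?_, ?_⟩
    · rwa [EventuallyEq, ae_restrict_iff' measurableSet_uIoc]
    · rw [h2, intervalIntegral.integral_congr_ae hae]
  have hbd : ∀ t, 0 ≤ t → IsSolutionOn f u t ξ → ‖ξ t‖ ≤ M ⌊t⌋₊ := fun t ht h =>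
    hM _ t (Nat.lt_floor_add_one t).le ξ hξ0 h t ⟨ht, le_rfl⟩
  -- Continuous induction in `t`: a solution satisfies the bound `M`, the cutoff is inactive up to
  -- `M + 1`, and this unit gap lets the solution property extend to the right.
  refine (IsClosed.Icc_subset_of_forall_exists_gt (s := {t | IsSolutionOn f u t ξ}) (a := 0) (b := T)
    ?_ ?_ ?_) ⟨hT, le_rfl⟩
  · refine isClosed_of_closure_subset fun t ht => ?_
    have htI : t ∈ Icc 0 T := closure_minimal inter_subset_right isClosed_Icc ht
    refine ⟨hkey t fun s hs => ?_, htI⟩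
    obtain ⟨t', ht', hst'⟩ := mem_closure_iff_nhds.1 ht (Ioi s) (Ioi_mem_nhds hs.2)
    have := hbd s hs.1 (IsSolutionOn.mono hst'.1 (le_of_lt ht'))
    linarith
  · exact hkey 0 fun s hs => absurd hs.1 (not_le.2 hs.2)
  · rintro t ⟨ht, ht0, htT⟩ y hy
    have hc : ContinuousWithinAt ξ (Ici t) t := by
      have := (hξ T).continuousOn t ⟨ht0, htT.le⟩
      refine this.mono_of_mem_nhdsWithin ?_
      filter_upwards [self_mem_nhdsWithin, mem_nhdsWithin_of_mem_nhds (gt_mem_nhds htT)]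
        with s hs hsT using ⟨ht0.trans hs, le_of_lt hsT⟩
    have hb := hbd t ht0 ht
    have h1 : ∀ᶠ s in 𝓝[Ici t] t, ‖ξ s‖ < M ⌊t⌋₊ + 1 :=
      hc.norm.eventually_lt continuousWithinAt_const (by linarith)
    have h2 : ∀ᶠ s : ℝ in 𝓝[Ici t] t, s < ⌊t⌋₊ + 1 :=
      mem_nhdsWithin_of_mem_nhds (gt_mem_nhds (Nat.lt_floor_add_one t))
    -- Staying below `⌊t⌋ + 1` keeps the floor, and hence the cutoff radius, unchanged.
    obtain ⟨z, hz, hzs⟩ := (mem_nhdsGE_iff_exists_Ico_subset' (show t < y from hy)).1 (h1.and h2)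
    refine ⟨min z y, hkey _ fun s hs => ?_, lt_min hz hy, min_le_right _ _⟩
    rcases lt_or_ge s t with hst | hst
    · have := hbd s hs.1 (ht.mono hst.le)
      linarith
    · obtain ⟨h3, h4⟩ := hzs ⟨hst, hs.2.trans_le (min_le_left _ _)⟩
      have : ⌊s⌋₊ = ⌊t⌋₊ :=
        (Nat.floor_eq_iff hs.1).2 ⟨(Nat.floor_le ht0).trans hst, h4⟩
      rw [this]
      exact h3.le

end GlobalExistence

/-! ### Integration of almost-everywhere decay inequalities. -/

section Comparison

theorem le_of_ae_deriv_nonpos {g : ℝ → ℝ} {a b : ℝ} (hab : a ≤ b)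
    (hg : AbsolutelyContinuousOnInterval g a b)
    (hd : ∀ᵐ t, t ∈ Ioo a b → DifferentiableAt ℝ g t → deriv g t ≤ 0) : g b ≤ g a := by
  have hne : ∀ᵐ t : ℝ, t ≠ b := by simp [ae_iff, measure_singleton]
  have h : ∫ t in a..b, deriv g t ≤ ∫ t in a..b, (0 : ℝ) := by
    refine intervalIntegral.integral_mono_ae_restrict hab hg.intervalIntegrable_deriv
      intervalIntegrable_const ?_
    rw [EventuallyLE, ae_restrict_iff' measurableSet_Icc]
    have hne' : ∀ᵐ t : ℝ, t ≠ a := by simp [ae_iff, measure_singleton]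
    filter_upwards [hd, hne, hne'] with t ht htb hta htI
    by_cases hdiff : DifferentiableAt ℝ g t
    · exact ht ⟨lt_of_le_of_ne htI.1 (Ne.symm hta), lt_of_le_of_ne htI.2 htb⟩ hdiff
    -- At points of nondifferentiability `deriv` takes the default value `0`, which is harmless
    -- here.
    · exact (deriv_zero_of_not_differentiableAt hdiff).le
  rw [hg.integral_deriv_eq_sub, intervalIntegral.integral_zero] at h
  linarith

/-- `k` may fail to be Lipschitz near `0`; truncating its argument at `δ` confines it to a compact
interval of `(0, ∞)`. -/
theorem LipschitzOnWith.exists_comp_max {k p : ℝ → ℝ} {a b δ : ℝ} {K : NNReal} (hδ : 0 < δ)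
    (hk : ContDiffOn ℝ 1 k (Ioi 0)) (hp : LipschitzOnWith K p (Icc a b)) :
    ∃ L, LipschitzOnWith L (fun t => k (max (p t) δ)) (Icc a b) := by
  obtain ⟨R, hR⟩ := isCompact_Icc.bddAbove_image hp.continuousOn
  obtain ⟨L, hL⟩ := (hk.mono (t := Icc δ (max R δ)) fun x hx => hδ.trans_le hx.1).exists_lipschitzOnWith
    one_ne_zero (convex_Icc _ _) isCompact_Icc
  have hp' : LipschitzOnWith K (fun t => max (p t) δ) (Icc a b) :=
    LipschitzOnWith.of_dist_le_mul fun x hx y hy =>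
      (abs_max_sub_max_le_abs _ _ _).trans (hp.dist_le_mul x hx y hy)
  exact ⟨L * K, hL.comp hp' fun t ht =>
    ⟨le_max_right _ _, max_le_max (hR (mem_image_of_mem p ht)) le_rfl⟩⟩

/-- Exponential decay of the maximum of two rescaled Lipschitz functions, each of which decays whenever it
is active. -/
theorem exp_mul_max_le {k₁ k₂ p r : ℝ → ℝ} {a b : ℝ} (hab : a ≤ b)
    (hk₁ : ClassKInf k₁) (hk₂ : ClassKInf k₂) (hk₁' : ContDiffOn ℝ 1 k₁ (Ioi 0))
    (hk₂' : ContDiffOn ℝ 1 k₂ (Ioi 0)) {K : NNReal} (hp : LipschitzOnWith K p (Icc a b))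
    (hr : LipschitzOnWith K r (Icc a b)) (hp0 : ∀ t, 0 ≤ p t) (hr0 : ∀ t, 0 ≤ r t)
    (hpos : ∀ t ∈ Icc a b, 0 < max (k₁ (p t)) (k₂ (r t)))
    (hd : ∀ᵐ t, t ∈ Ioo a b → ∃ p' r', HasDerivAt p p' t ∧ HasDerivAt r r' t ∧
      (max (k₁ (p t)) (k₂ (r t)) = k₁ (p t) →
        deriv k₁ (p t) * p' ≤ -max (k₁ (p t)) (k₂ (r t))) ∧
      (max (k₁ (p t)) (k₂ (r t)) = k₂ (r t) →
        deriv k₂ (r t) * r' ≤ -max (k₁ (p t)) (k₂ (r t)))) :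
    Real.exp b * max (k₁ (p b)) (k₂ (r b)) ≤ Real.exp a * max (k₁ (p a)) (k₂ (r a)) := by
  set W : ℝ → ℝ := fun t => max (k₁ (p t)) (k₂ (r t)) with hW
  have hWc : ContinuousOn W (Icc a b) :=
    (hk₁.cont.comp hp.continuousOn fun t _ => hp0 t).sup (hk₂.cont.comp hr.continuousOn fun t _ => hr0 t)
  obtain ⟨t₀, ht₀, hmin⟩ := isCompact_Icc.exists_isMinOn ⟨a, left_mem_Icc.2 hab⟩ hWc
  have hm := hpos t₀ ht₀
  -- Truncating both components at the positive minimum `W t₀` leaves their maximum unchanged and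
  -- avoids the possible singularity of `k₁`, `k₂` at `0`.
  have hWL : ∃ L, LipschitzOnWith L W (Icc a b) := by
    have key : ∀ {k : ℝ → ℝ} (_ : ClassKInf k) {s : ℝ}, 0 ≤ s →
        k (max s (kInv k (W t₀))) = max (k s) (W t₀) := by
      intro k hk s hs
      have h0 := hk.kInv_nonneg hm.le
      rw [hk.strictMono.monotoneOn.map_max hs h0, hk.apply_kInv hm.le]
    obtain ⟨L₁, hL₁⟩ := hp.exists_comp_max (hk₁.kInv.pos hm) hk₁'
    obtain ⟨L₂, hL₂⟩ := hr.exists_comp_max (hk₂.kInv.pos hm) hk₂'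
    refine ⟨max L₁ L₂, LipschitzOnWith.of_dist_le_mul fun x hx y hy => ?_⟩
    have e : ∀ t ∈ Icc a b, W t =
        max (k₁ (max (p t) (kInv k₁ (W t₀)))) (k₂ (max (r t) (kInv k₂ (W t₀)))) := by
      intro t ht
      rw [key hk₁ (hp0 t), key hk₂ (hr0 t), max_max_max_comm, max_self]
      exact (max_eq_left (hmin ht)).symm
    rw [e x hx, e y hy]
    refine (abs_max_sub_max_le_max _ _ _ _).trans (max_le ?_ ?_)
    · refine (hL₁.dist_le_mul x hx y hy).trans (mul_le_mul_of_nonneg_right ?_ dist_nonneg)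
      exact_mod_cast le_max_left L₁ L₂
    · refine (hL₂.dist_le_mul x hx y hy).trans (mul_le_mul_of_nonneg_right ?_ dist_nonneg)
      exact_mod_cast le_max_right L₁ L₂
  obtain ⟨L, hL⟩ := hWL
  rw [← uIcc_of_le hab] at hL
  have hAC : AbsolutelyContinuousOnInterval (fun t => Real.exp t * W t) a b :=
    (Real.contDiff_exp.contDiffOn.absolutelyContinuousOnInterval).mul hL.absolutelyContinuousOnInterval
  refine le_of_ae_deriv_nonpos hab hAC ?_
  filter_upwards [hd] with t ht htI hdiff
  obtain ⟨p', r', hp', hr', h1, h2⟩ := ht htI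
  have hWt := hpos t (Ioo_subset_Icc_self htI)
  have hWd : DifferentiableAt ℝ W t := by
    have : W = fun t => Real.exp (-t) * (Real.exp t * W t) := by
      funext t
      rw [← mul_assoc, ← Real.exp_add]
      simp
    rw [this]
    exact DifferentiableAt.mul (by fun_prop) hdiff
  have hdW : deriv W t ≤ -W t := by
    have key : ∀ (k s : ℝ → ℝ) (s' : ℝ), ClassKInf k → ContDiffOn ℝ 1 k (Ioi 0) → HasDerivAt s s' t →
        (∀ t, 0 ≤ s t) → (∀ t, k (s t) ≤ W t) → W t = k (s t) → deriv W t = deriv k (s t) * s' := by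
      intro k s s' hk hk' hs hs0 hle heq
      have hst : 0 < s t := by
        refine (hs0 t).lt_of_ne fun h => ?_
        refine hWt.ne' ?_
        change W t = 0
        rw [heq, ← h, hk.zero]
      have h1 : HasDerivAt k (deriv k (s t)) (s t) :=
        ((hk'.differentiableOn one_ne_zero).differentiableAt (Ioi_mem_nhds hst)).hasDerivAt
      have h2 : HasDerivAt (fun t => k (s t)) (deriv k (s t) * s') t := h1.comp t hs
      have h3 := fderiv_eq_of_le_of_eq h2.differentiableAt hWd hle heq.symm
      have h4 : deriv (fun t => k (s t)) t = deriv W t := by simp only [← fderiv_apply_one_eq_deriv, h3]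
      rw [← h4, h2.deriv]
    rcases max_choice (k₁ (p t)) (k₂ (r t)) with h | h
    · rw [key k₁ p p' hk₁ hk₁' hp' hp0 (fun t => le_max_left _ _) h]
      exact h1 h
    · rw [key k₂ r r' hk₂ hk₂' hr' hr0 (fun t => le_max_right _ _) h]
      exact h2 h
  rw [deriv_fun_mul Real.differentiableAt_exp hWd, Real.deriv_exp]
  nlinarith [Real.exp_pos t]

/-- A function that decays exponentially while it is above the threshold `Θ` is bounded by the maximum of
the exponential and the threshold. -/
theorem le_max_exp_of_decay {W : ℝ → ℝ} {T Θ : ℝ} (hW : ContinuousOn W (Icc 0 T)) (hΘ : 0 ≤ Θ)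
    (hdecay : ∀ a b, 0 ≤ a → a ≤ b → b ≤ T → (∀ t ∈ Icc a b, Θ ≤ W t ∧ 0 < W t) →
      Real.exp b * W b ≤ Real.exp a * W a) {t : ℝ} (ht : t ∈ Icc 0 T) :
    W t ≤ max (Real.exp (-t) * W 0) Θ := by
  by_contra! hcon
  obtain ⟨h1, h2⟩ := max_lt_iff.1 hcon
  by_cases hall : ∀ s ∈ Icc 0 t, Θ < W s
  · have := hdecay 0 t le_rfl ht.1 ht.2 fun s hs => ⟨(hall s hs).le, hΘ.trans_lt (hall s hs)⟩
    rw [Real.exp_zero, one_mul] at this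
    have h3 := mul_lt_mul_of_pos_left h1 (Real.exp_pos t)
    rw [← mul_assoc, ← Real.exp_add, add_neg_cancel, Real.exp_zero, one_mul] at h3
    exact absurd this (not_le.2 h3)
  · push Not at hall
    -- The last time `s₀` at which `W ≤ Θ`. Just after it `W` is still below `W t`, yet decay holds
    -- from there to `t`: a contradiction. Starting after `s₀` guarantees `W > 0`, which may fail at
    -- `s₀` if `Θ = 0`.
    have hcpt : IsCompact (Icc 0 t ∩ W ⁻¹' Iic Θ) := by
      refine isCompact_Icc.of_isClosed_subset ?_ inter_subset_left
      exact (hW.mono (Icc_subset_Icc_right ht.2)).preimage_isClosed_of_isClosed isClosed_Icc isClosed_Iic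
    have hmem := hcpt.sSup_mem hall
    set s₀ := sSup (Icc 0 t ∩ W ⁻¹' Iic Θ) with hs₀
    have hlt : s₀ < t := lt_of_le_of_ne hmem.1.2 fun h => by
      have := hmem.2
      rw [h] at this
      exact absurd h2 (not_lt.2 this)
    have habove : ∀ s ∈ Ioc s₀ t, Θ < W s := by
      intro s hs
      by_contra! hle
      exact absurd (le_csSup hcpt.bddAbove ⟨⟨hmem.1.1.trans hs.1.le, hs.2⟩, hle⟩) (not_le.2 hs.1)
    have hc : ContinuousWithinAt W (Ioi s₀) s₀ := by
      refine (hW s₀ ⟨hmem.1.1, hlt.le.trans ht.2⟩).mono_of_mem_nhdsWithin ?_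
      filter_upwards [self_mem_nhdsWithin, mem_nhdsWithin_of_mem_nhds (gt_mem_nhds hlt)] with s hs hst
      exact ⟨hmem.1.1.trans (le_of_lt hs), (le_of_lt hst).trans ht.2⟩
    have h3 : ∀ᶠ s in 𝓝[>] s₀, W s < W t :=
      hc.eventually_lt continuousWithinAt_const (lt_of_le_of_lt hmem.2 h2)
    obtain ⟨s, ⟨hs1, hs2⟩, hs3⟩ := ((h3.and (mem_nhdsWithin_of_mem_nhds (gt_mem_nhds hlt))).and
      self_mem_nhdsWithin).exists
    have hs2 : s < t := hs2
    have hs3 : s₀ < s := hs3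
    have h4 := hdecay s t (hmem.1.1.trans hs3.le) hs2.le ht.2 fun y hy => by
      have := habove y ⟨hs3.trans_le hy.1, hy.2⟩
      exact ⟨this.le, hΘ.trans_lt this⟩
    have h5 : Real.exp s * W s ≤ Real.exp t * W s :=
      mul_le_mul_of_nonneg_right (Real.exp_le_exp.2 hs2.le) (hΘ.trans (habove s ⟨hs3, hs2.le⟩).le)
    have h6 := mul_lt_mul_of_pos_left hs1 (Real.exp_pos t)
    linarith

end Comparison

/-! ### Regularity of trajectories. -/

section Trajectories

variable {X U : Type*} [NormedAddCommGroup X] [NormedSpace ℝ X] {f : X → U → X} {u : ℝ → U} {T : ℝ}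
  {ξ : ℝ → X}

theorem IsSolutionOn.exists_lipschitzOnWith [NormedAddCommGroup U] [MeasurableSpace U]
    [MeasurableSpace X] (hf : RegularRHS f) (h : IsSolutionOn f u T ξ) {c : ℝ}
    (hc : ∀ᵐ t, t ∈ Icc 0 T → ‖u t‖ ≤ c) : ∃ K, LipschitzOnWith K ξ (Icc 0 T) := by
  obtain ⟨B, L, hB0, -, hB⟩ := hf.exists_bound_lipschitz (isCompact_Icc.image_of_continuousOn h.continuousOn) c
  refine ⟨⟨B, hB0⟩, LipschitzOnWith.of_dist_le_mul fun s hs t ht => ?_⟩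
  rw [dist_eq_norm, (h s hs).2, (h t ht).2, add_sub_add_left_eq_sub,
    intervalIntegral.integral_interval_sub_left (h s hs).1 (h t ht).1]
  refine intervalIntegral.norm_integral_le_of_norm_le_const_ae ?_
  filter_upwards [hc] with r hr hrI
  have hrI' : r ∈ Icc 0 T := ordConnected_Icc.uIcc_subset ht hs (uIoc_subset_uIcc hrI)
  exact (hB (u r) (hr hrI')).1 _ (mem_image_of_mem ξ hrI')

/-- Lebesgue differentiation of the integral equation; `L` stands for the projections onto the slow
and fast components. -/
theorem IsSolutionOn.ae_hasDerivAt [CompleteSpace X] (h : IsSolutionOn f u T ξ) {Y : Type*}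
    [NormedAddCommGroup Y] [NormedSpace ℝ Y] (L : X →L[ℝ] Y) :
    ∀ᵐ t, t ∈ Ioo 0 T → HasDerivAt (fun s => L (ξ s)) (L (f (ξ t) (u t))) t := by
  rcases lt_or_ge T 0 with hT | hT
  · simp [Ioo_eq_empty_of_le hT.le]
  filter_upwards [(h T ⟨hT, le_rfl⟩).1.ae_hasDerivAt_integral] with t ht htI
  have h1 := ht (by rw [uIcc_of_le hT]; exact Ioo_subset_Icc_self htI) 0 left_mem_uIcc
  refine L.hasFDerivAt.comp_hasDerivAt t ((h1.const_add (ξ 0)).congr_of_eventuallyEq ?_)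
  filter_upwards [isOpen_Ioo.mem_nhds htI] with s hs using (h s (Ioo_subset_Icc_self hs)).2

end Trajectories

/-! ### The Lyapunov estimate along solutions. -/

section ShiftedSystem

variable {n m p q : ℕ}

theorem shiftedSystem_regularRHS
    {ρs : Euc n → Euc m → Euc p → ℝ} {gs : Euc n → Euc m → Euc p → Euc n}
    {ρf : Euc m → Euc n → Euc q → ℝ} {gf : Euc m → Euc n → Euc q → Euc m}
    (hregs : RegularRHS (fun (a : Euc n × Euc m) (d : Euc p) => ρs a.1 a.2 d • gs a.1 a.2 d))
    (hregf : RegularRHS (fun (a : Euc n × Euc m) (w : Euc q) => ρf a.2 a.1 w • gf a.2 a.1 w))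
    (z₀ : Euc m) : RegularRHS (shiftedSystem ρs gs ρf gf z₀) where
  lipschitz := by
    intro ξ₀ R
    obtain ⟨δ₁, hδ₁, K₁, hK₁⟩ := hregs.lipschitz (ξ₀.fst, ξ₀.snd + z₀) R
    obtain ⟨δ₂, hδ₂, K₂, hK₂⟩ := hregf.lipschitz (ξ₀.fst, ξ₀.snd + z₀) R
    have hdist : ∀ ξ η : EucProd n m,
        ‖((ξ.fst, ξ.snd + z₀) : Euc n × Euc m) - (η.fst, η.snd + z₀)‖ ≤ ‖ξ - η‖ := by
      intro ξ η
      rw [Prod.mk_sub_mk, add_sub_add_right_eq_sub]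
      exact max_le (WithLp.norm_fst_le _ (ξ - η)) (WithLp.norm_snd_le _ (ξ - η))
    have hball : ∀ (δ : ℝ) (ξ : EucProd n m), ξ ∈ Metric.ball ξ₀ (min δ₁ δ₂) → min δ₁ δ₂ ≤ δ →
        ((ξ.fst, ξ.snd + z₀) : Euc n × Euc m) ∈ Metric.ball (ξ₀.fst, ξ₀.snd + z₀) δ := by
      intro δ ξ hξ hδ
      rw [mem_ball_iff_norm] at hξ ⊢
      exact (hdist ξ ξ₀).trans_lt (hξ.trans_le hδ)
    refine ⟨min δ₁ δ₂, lt_min hδ₁ hδ₂, max K₁ 0 + max K₂ 0, fun u hu ξ hξ η hη => ?_⟩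
    have h1 := hK₁ u.fst ((WithLp.norm_fst_le _ u).trans hu) _ (hball _ ξ hξ (min_le_left _ _)) _
      (hball _ η hη (min_le_left _ _))
    have h2 := hK₂ u.snd ((WithLp.norm_snd_le _ u).trans hu) _ (hball _ ξ hξ (min_le_right _ _)) _
      (hball _ η hη (min_le_right _ _))
    have hlift : ∀ K : ℝ, K * ‖((ξ.fst, ξ.snd + z₀) : Euc n × Euc m) - (η.fst, η.snd + z₀)‖ ≤
        max K 0 * ‖ξ - η‖ := fun K =>
      mul_le_mul (le_max_left _ _) (hdist ξ η) (norm_nonneg _) (le_max_right _ _)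
    rw [add_mul]
    exact (norm_eucProd_le _).trans (add_le_add (h1.trans (hlift K₁)) (h2.trans (hlift K₂)))
  measurable := by
    intro ξ
    have h1 : Measurable fun u : EucProd p q => u.fst :=
      measurable_fst.comp (WithLp.measurable_ofLp 2 _)
    have h2 : Measurable fun u : EucProd p q => u.snd :=
      measurable_snd.comp (WithLp.measurable_ofLp 2 _)
    exact (WithLp.measurable_toLp 2 _).comp
      (((hregs.measurable (ξ.fst, ξ.snd + z₀)).comp h1).prodMk
        ((hregf.measurable (ξ.fst, ξ.snd + z₀)).comp h2))
  bounded := by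
    intro ξ R
    obtain ⟨B₁, hB₁⟩ := hregs.bounded (ξ.fst, ξ.snd + z₀) R
    obtain ⟨B₂, hB₂⟩ := hregf.bounded (ξ.fst, ξ.snd + z₀) R
    exact ⟨B₁ + B₂, fun u hu => (norm_eucProd_le _).trans
      (add_le_add (hB₁ u.fst ((WithLp.norm_fst_le _ u).trans hu))
        (hB₂ u.snd ((WithLp.norm_snd_le _ u).trans hu)))⟩

/-- The composite Lyapunov function along solutions, in terms of a rescaling `κ` that makes the decay
exponential. -/
theorem maxLyapunov_le_along_solution
    {ρs : Euc n → Euc m → Euc p → ℝ} {gs : Euc n → Euc m → Euc p → Euc n}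
    {ρf : Euc m → Euc n → Euc q → ℝ} {gf : Euc m → Euc n → Euc q → Euc m}
    (hregs : RegularRHS (fun (a : Euc n × Euc m) (d : Euc p) => ρs a.1 a.2 d • gs a.1 a.2 d))
    (hregf : RegularRHS (fun (a : Euc n × Euc m) (w : Euc q) => ρf a.2 a.1 w • gf a.2 a.1 w))
    {Vs : Euc n → ℝ} {Vf : Euc m → Euc n → ℝ} {γs γf σ α κ χs χf : ℝ → ℝ}
    (hVs : ContDiff ℝ 1 Vs) (hVf : ContDiff ℝ 1 (fun a : Euc m × Euc n => Vf a.1 a.2))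
    (hVs0 : ∀ x, 0 ≤ Vs x) (hVf0 : ∀ z x, 0 ≤ Vf z x) (hσ : ScalingFunction γs γf σ)
    (hχs : ClassK χs) (hχf : ClassK χf)
    (hdecay : ∀ x z d w, 0 < maxLyapunov Vs Vf σ x z →
      max (χs ‖d‖) (σ (χf ‖w‖)) ≤ maxLyapunov Vs Vf σ x z →
      (maxLyapunov Vs Vf σ x z = Vs x →
        fderiv ℝ Vs x (ρs x z d • gs x z d) ≤ -α (maxLyapunov Vs Vf σ x z)) ∧
      (maxLyapunov Vs Vf σ x z = σ (Vf z x) →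
        deriv σ (Vf z x) * fderiv ℝ (fun a : Euc m × Euc n => Vf a.1 a.2) (z, x)
          (ρf z x w • gf z x w, ρs x z d • gs x z d) ≤ -α (maxLyapunov Vs Vf σ x z)))
    (hκ : ClassKInf κ) (hκ' : ContDiffOn ℝ 1 κ (Ioi 0)) (hκd : ∀ r, 0 < r → 0 ≤ deriv κ r)
    (hκα : ∀ r, 0 < r → κ r ≤ deriv κ r * α r) {z₀ : Euc m} {u : ℝ → EucProd p q} {T c : ℝ}
    (hc0 : 0 ≤ c) (hc : ∀ᵐ t, t ∈ Icc 0 T → ‖u t‖ ≤ c) {ξ : ℝ → EucProd n m}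
    (hξ : IsSolutionOn (shiftedSystem ρs gs ρf gf z₀) u T ξ) {t : ℝ} (ht : t ∈ Icc 0 T) :
    κ (maxLyapunov Vs Vf σ (ξ t).fst ((ξ t).snd + z₀)) ≤
      max (Real.exp (-t) * κ (maxLyapunov Vs Vf σ (ξ 0).fst ((ξ 0).snd + z₀)))
        (κ (max (χs c) (σ (χf c)))) := by
  have hK := hσ.classKInf
  set Fs : EucProd n m → ℝ := fun y => Vs y.fst with hFs
  set Ff : EucProd n m → ℝ := fun y => Vf (y.snd + z₀) y.fst with hFf
  have hfst : ContDiff ℝ 1 fun y : EucProd n m => y.fst :=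
    contDiff_fst.comp (WithLp.prodContinuousLinearEquiv 2 ℝ (Euc n) (Euc m)).contDiff
  have hsnd : ContDiff ℝ 1 fun y : EucProd n m => y.snd :=
    contDiff_snd.comp (WithLp.prodContinuousLinearEquiv 2 ℝ (Euc n) (Euc m)).contDiff
  have hFsd : ContDiff ℝ 1 Fs := hVs.comp hfst
  have hFfd : ContDiff ℝ 1 Ff := hVf.comp ((hsnd.add contDiff_const).prodMk hfst)
  have hV0 : ∀ x z, 0 ≤ maxLyapunov Vs Vf σ x z := fun x z => (hVs0 x).trans (le_max_left _ _)
  -- A monotone function commutes with the maximum, so `κ(V)` is again a maximum of rescaled smooth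
  -- functions.
  have hκV : ∀ x z, κ (maxLyapunov Vs Vf σ x z) = max (κ (Vs x)) (κ (σ (Vf z x))) := fun x z =>
    hκ.strictMono.monotoneOn.map_max (hVs0 x) (hK.nonneg (hVf0 z x))
  have hθ : 0 ≤ max (χs c) (σ (χf c)) := (hχs.nonneg hc0).trans (le_max_left _ _)
  obtain ⟨K, hKξ⟩ := hξ.exists_lipschitzOnWith (shiftedSystem_regularRHS hregs hregf z₀) hc
  have hcpt := isCompact_Icc.image_of_continuousOn hξ.continuousOn
  obtain ⟨K₁, hK₁⟩ := hFsd.locallyLipschitz.locallyLipschitzOn.exists_lipschitzOnWith_of_compact hcpt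
  obtain ⟨K₂, hK₂⟩ := hFfd.locallyLipschitz.locallyLipschitzOn.exists_lipschitzOnWith_of_compact hcpt
  have hp : LipschitzOnWith (max (K₁ * K) (K₂ * K)) (fun t => Fs (ξ t)) (Icc 0 T) :=
    (hK₁.comp hKξ (mapsTo_image _ _)).weaken (le_max_left _ _)
  have hr : LipschitzOnWith (max (K₁ * K) (K₂ * K)) (fun t => Ff (ξ t)) (Icc 0 T) :=
    (hK₂.comp hKξ (mapsTo_image _ _)).weaken (le_max_right _ _)
  have hp0 : ∀ t, 0 ≤ Fs (ξ t) := fun t => hVs0 _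
  have hr0 : ∀ t, 0 ≤ Ff (ξ t) := fun t => hVf0 _ _
  have hκσ : ContDiffOn ℝ 1 (fun r => κ (σ r)) (Ioi 0) :=
    hκ'.comp hσ.contDiffOn fun r hr => hK.pos hr
  have hcont : ContinuousOn
      (fun t => κ (maxLyapunov Vs Vf σ (ξ t).fst ((ξ t).snd + z₀))) (Icc 0 T) := by
    simp only [hκV]
    exact (hκ.cont.comp hp.continuousOn fun t _ => hp0 t).sup
      ((hκ.comp hK).cont.comp hr.continuousOn fun t _ => hr0 t)
  refine le_max_exp_of_decay (W := fun t => κ (maxLyapunov Vs Vf σ (ξ t).fst ((ξ t).snd + z₀)))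
    hcont (hκ.nonneg hθ) (fun a b ha hab hb hW => ?_) ht
  have hsub : Icc a b ⊆ Icc 0 T := Icc_subset_Icc ha hb
  simp only [hκV] at hW ⊢
  refine exp_mul_max_le (k₁ := κ) (k₂ := fun r => κ (σ r)) (p := fun t => Fs (ξ t))
    (r := fun t => Ff (ξ t)) hab hκ (hκ.comp hK) hκ' hκσ (hp.mono hsub) (hr.mono hsub) hp0 hr0
    (fun t ht => (hW t ht).2) ?_
  filter_upwards [hξ.ae_hasDerivAt (WithLp.fstL 2 ℝ (Euc n) (Euc m)),
    hξ.ae_hasDerivAt (WithLp.sndL 2 ℝ (Euc n) (Euc m)), hc] with t htdx htdz htc htI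
  have htI' := hsub (Ioo_subset_Icc_self htI)
  have htI₀ : t ∈ Ioo 0 T := ⟨ha.trans_lt htI.1, htI.2.trans_le hb⟩
  have hu := htc htI'
  obtain ⟨hW1, hW2⟩ := hW t (Ioo_subset_Icc_self htI)
  set x := (ξ t).fst with hx
  set z := (ξ t).snd + z₀ with hz
  rw [← hκV] at hW1 hW2
  have hVpos : 0 < maxLyapunov Vs Vf σ x z := by
    rw [← hκ.zero, hκ.lt_iff le_rfl (hV0 x z)] at hW2
    exact hW2
  have hin : max (χs ‖(u t).fst‖) (σ (χf ‖(u t).snd‖)) ≤ maxLyapunov Vs Vf σ x z := by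
    refine le_trans (max_le_max ?_ ?_) ((hκ.le_iff hθ (hV0 x z)).1 hW1)
    · exact hχs.mono (norm_nonneg _) ((WithLp.norm_fst_le _ _).trans hu)
    · exact hK.mono (hχf.nonneg (norm_nonneg _))
        (hχf.mono (norm_nonneg _) ((WithLp.norm_snd_le _ _).trans hu))
  obtain ⟨h1, h2⟩ := hdecay x z (u t).fst (u t).snd hVpos hin
  have hdx := htdx htI₀
  have hdz := (htdz htI₀).add_const z₀
  -- Multiplication by `κ'` turns the rate `-α(V)` into `-κ(V)`.
  have hscale : ∀ {y : ℝ}, y ≤ -α (maxLyapunov Vs Vf σ x z) →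
      deriv κ (maxLyapunov Vs Vf σ x z) * y ≤ -κ (maxLyapunov Vs Vf σ x z) := by
    intro y hy
    have h3 := mul_le_mul_of_nonneg_left hy (hκd _ hVpos)
    have h4 := hκα _ hVpos
    linarith
  refine ⟨_, _, (hVs.differentiable one_ne_zero x).hasFDerivAt.comp_hasDerivAt t hdx,
    HasFDerivAt.comp_hasDerivAt (f := fun t => ((ξ t).snd + z₀, (ξ t).fst)) t
      (hVf.differentiable one_ne_zero (z, x)).hasFDerivAt (hdz.prodMk hdx), fun heq => ?_,
    fun heq => ?_⟩
  · simp only [hFs, hFf, ← hx, ← hz] at heq ⊢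
    rw [← hκV] at heq ⊢
    have heq' := hκ.strictMono.injOn (hV0 x z) (hVs0 x) heq
    have := hscale (h1 heq')
    rw [heq'] at this ⊢
    exact this
  · simp only [hFs, hFf, ← hx, ← hz] at heq ⊢
    rw [← hκV] at heq ⊢
    have heq' := hκ.strictMono.injOn (hV0 x z) (hK.nonneg (hVf0 z x)) heq
    have hVfpos : 0 < Vf z x := by
      refine (hVf0 z x).lt_of_ne fun h => ?_
      rw [heq', ← h, hK.zero] at hVpos
      exact lt_irrefl _ hVpos
    have hκσd : deriv (fun r => κ (σ r)) (Vf z x) = deriv κ (σ (Vf z x)) * deriv σ (Vf z x) :=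
      (HasDerivAt.comp (h₂ := κ) (Vf z x) ((hκ'.differentiableOn one_ne_zero).differentiableAt
        (Ioi_mem_nhds (hK.pos hVfpos))).hasDerivAt (hσ.hasDerivAt hVfpos)).deriv
    have := hscale (h2 heq')
    rw [heq', ← mul_assoc] at this
    rw [hκσd, heq']
    exact this

end ShiftedSystem

/-! ### From the Lyapunov estimate to input-to-state stability. -/

section InputToState

/-- A continuous function has a continuous nondecreasing modulus of growth around the origin. -/
theorem exists_growth_modulus {E F : Type*} [NormedAddCommGroup E] [NormedSpace ℝ E] [ProperSpace E]
    [NormedAddCommGroup F] {φ : E → F} (hφ : Continuous φ) :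
    ∃ ω : ℝ → ℝ, Continuous ω ∧ MonotoneOn ω (Ici 0) ∧ ω 0 = 0 ∧ ∀ x, ‖φ x - φ 0‖ ≤ ω ‖x‖ := by
  -- Scaling the argument makes this a supremum over a fixed compact ball, so that it is continuous
  -- in `r`.
  set ω : ℝ → ℝ := fun r => sSup ((fun y => ‖φ (r • y) - φ 0‖) '' Metric.closedBall 0 1) with hω
  have hne : (Metric.closedBall (0 : E) 1).Nonempty := ⟨0, by simp⟩
  have hcpt : ∀ r : ℝ, IsCompact ((fun y => ‖φ (r • y) - φ 0‖) '' Metric.closedBall 0 1) := fun r =>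
    (isCompact_closedBall 0 1).image (by fun_prop)
  have hle : ∀ x, ∀ r, ‖x‖ ≤ r → ‖φ x - φ 0‖ ≤ ω r := by
    intro x r hx
    refine le_csSup (hcpt r).bddAbove ?_
    rcases ((norm_nonneg x).trans hx).eq_or_lt with h0 | h0
    · have : x = 0 := by rw [← h0] at hx; exact norm_le_zero_iff.1 hx
      exact ⟨0, by simp, by simp [this]⟩
    · refine ⟨r⁻¹ • x, ?_, by simp [smul_smul, h0.ne']⟩
      rw [mem_closedBall_zero_iff, norm_smul, norm_inv, Real.norm_of_nonneg h0.le, inv_mul_eq_div]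
      exact (div_le_one h0).2 hx
  refine ⟨ω, ?_, ?_, ?_, fun x => hle x _ le_rfl⟩
  · refine (isCompact_closedBall (0 : E) 1).continuous_sSup (f := fun r y => ‖φ (r • y) - φ 0‖) ?_
    simp only [Function.HasUncurry.uncurry, id]
    fun_prop
  · intro r hr s _ hrs
    refine csSup_le (hne.image _) ?_
    rintro _ ⟨y, hy, rfl⟩
    refine hle _ _ ?_
    rw [mem_closedBall_zero_iff] at hy
    rw [norm_smul, Real.norm_of_nonneg hr]
    exact (mul_le_of_le_one_right hr hy).trans hrs
  · simp only [hω, zero_smul, sub_self, norm_zero]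
    rw [hne.image_const, csSup_singleton]

theorem ClassKInf.classKL_exp {A B : ℝ → ℝ} (hA : ClassKInf A) (hB : ClassKInf B) :
    ClassKL (fun s t => A (Real.exp (-t) * B s)) where
  cont := by
    refine hA.cont.comp ?_ fun a ha => mul_nonneg (Real.exp_pos _).le (hB.nonneg ha.1)
    exact ContinuousOn.mul (by fun_prop) (hB.cont.comp continuousOn_fst fun a ha => ha.1)
  classK := fun t _ => hA.toClassK.comp
    ((classKInf_mul_left (Real.exp_pos (-t))).toClassK.comp hB.toClassK)
  anti := by
    intro s hs t _ t' _ htt'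
    have h0 := hB.nonneg hs.le
    refine hA.mono (mul_nonneg (Real.exp_pos _).le h0) ?_
    exact mul_le_mul_of_nonneg_right (Real.exp_le_exp.2 (neg_le_neg htt')) h0
  tendsto := by
    intro s hs
    have h1 : Tendsto (fun t => Real.exp (-t) * B s) atTop (𝓝[Ici 0] 0) := by
      refine tendsto_nhdsWithin_iff.2 ⟨?_, Eventually.of_forall fun t =>
        mul_nonneg (Real.exp_pos _).le (hB.nonneg hs.le)⟩
      have := (Real.tendsto_exp_neg_atTop_nhds_zero).mul_const (B s)
      rwa [zero_mul] at this
    have h2 : Tendsto A (𝓝[Ici 0] 0) (𝓝 0) := by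
      have := hA.cont 0 self_mem_Ici
      rwa [ContinuousWithinAt, hA.zero] at this
    exact h2.comp h1

/-- Input-to-state stability from an estimate of all solutions on bounded intervals: global existence is
automatic for regular right-hand sides. -/
theorem RegularRHS.isISS_of_estimate {X U : Type*} [NormedAddCommGroup X] [NormedSpace ℝ X]
    [FiniteDimensional ℝ X] [MeasurableSpace X] [BorelSpace X] [NormedAddCommGroup U] [MeasurableSpace U]
    [BorelSpace U] {f : X → U → X} (hf : RegularRHS f) {β : ℝ → ℝ → ℝ} {χ : ℝ → ℝ}
    (hβ : ClassKL β) (hχ : ClassK χ)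
    (hest : ∀ (u : ℝ → U) (T c : ℝ) (ξ : ℝ → X), 0 ≤ c → (∀ᵐ t, t ∈ Icc 0 T → ‖u t‖ ≤ c) →
      IsSolutionOn f u T ξ → ∀ t ∈ Icc 0 T, ‖ξ t‖ ≤ max (β ‖ξ 0‖ t) (χ c)) : IsISS f := by
  refine ⟨β, χ, hβ, hχ, fun u hu => ⟨fun ξ₀ => ?_, fun T ξ hξ c hc t ht => ?_⟩⟩
  · refine hf.exists_global_solution hu ξ₀ fun T => ?_
    obtain ⟨c, hc⟩ := hu.2 T
    rw [ae_restrict_iff' measurableSet_Icc] at hc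
    refine ⟨max (β ‖ξ₀‖ 0) (χ (max c 0)), fun T' hT' ξ hξ0 hξ t ht => ?_⟩
    have hc' : ∀ᵐ t, t ∈ Icc 0 T' → ‖u t‖ ≤ max c 0 := by
      filter_upwards [hc] with s hs hsI
      exact (hs ⟨hsI.1, hsI.2.trans hT'⟩).trans (le_max_left _ _)
    refine (hest u T' _ ξ (le_max_right _ _) hc' hξ t ht).trans (max_le_max ?_ le_rfl)
    rw [hξ0]
    -- Monotonicity of `β s` in time is part of class 𝒦ℒ only for `s > 0`; at `s = 0` both values
    -- are zero.
    rcases (norm_nonneg ξ₀).eq_or_lt with h0 | h0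
    · rw [← h0, (hβ.classK t ht.1).zero, (hβ.classK 0 le_rfl).zero]
    · exact hβ.anti _ h0 self_mem_Ici ht.1 ht.1
  -- The half-line has positive measure, so the essential bound holds at some time, which forces `c
  -- ≥ 0`.
  · have hc0 : 0 ≤ c := by
      have hne : NeBot (ae (volume.restrict (Ici (0 : ℝ)))) := by
        rw [ae_neBot]
        intro h
        simpa using congrArg (fun μ => μ univ) h
      obtain ⟨s, hs⟩ := hc.exists
      exact (norm_nonneg _).trans hs
    rw [ae_restrict_iff' measurableSet_Ici] at hc
    refine hest u T c ξ hc0 ?_ hξ t ht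
    filter_upwards [hc] with s hs hsI using hs hsI.1

variable {n m p q : ℕ}

/-- Applied with `(x, z - φ(x))` and `(x, z - φ(0))` in either role: they differ only by `φ(x) -
φ(0)` in the second component. -/
theorem norm_eucProd_shift_le {φ : Euc n → Euc m} {ω : ℝ → ℝ} (hmono : MonotoneOn ω (Ici 0))
    (hφ : ∀ x, ‖φ x - φ 0‖ ≤ ω ‖x‖) (y y' : EucProd n m) (hfst : y.fst = y'.fst)
    (hsnd : ‖y.snd - y'.snd‖ ≤ ‖φ y.fst - φ 0‖) : ‖y‖ ≤ ‖y'‖ + ω ‖y'‖ := by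
  have h1 : ‖y - y'‖ ≤ ω ‖y'‖ := by
    refine (norm_eucProd_le _).trans ?_
    rw [WithLp.sub_fst, WithLp.sub_snd, hfst, sub_self, norm_zero, zero_add]
    refine hsnd.trans ((hφ _).trans (hmono (norm_nonneg _) (norm_nonneg _) ?_))
    rw [hfst]
    exact WithLp.norm_fst_le _ y'
  calc ‖y‖ = ‖y' + (y - y')‖ := by rw [add_sub_cancel]
    _ ≤ _ := (norm_add_le _ _).trans (add_le_add le_rfl h1)

end InputToState

/-! ### Assembly of the main theorem. -/

theorem theorem1 {n m p q : ℕ}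
    (ρs : Euc n → Euc m → Euc p → ℝ) (gs : Euc n → Euc m → Euc p → Euc n)
    (ρf : Euc m → Euc n → Euc q → ℝ) (gf : Euc m → Euc n → Euc q → Euc m)
    (hρs : ∀ x z d, 0 ≤ ρs x z d) (hρf : ∀ z x w, 0 ≤ ρf z x w)
    (hregs : RegularRHS (fun (a : Euc n × Euc m) (d : Euc p) => ρs a.1 a.2 d • gs a.1 a.2 d))
    (hregf : RegularRHS (fun (a : Euc n × Euc m) (w : Euc q) => ρf a.2 a.1 w • gf a.2 a.1 w))
    (φ : Euc n → Euc m) (hφ : SteadyState gs gf φ)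
    (Vs : Euc n → ℝ) (Vf : Euc m → Euc n → ℝ)
    (αsl αsu γs χs αs : ℝ → ℝ) (hslow : SlowLyapunov gs Vs Vf αsl αsu γs χs αs)
    (αfl αfu χf αf lf1 lf2 : ℝ → ℝ) (hfast : FastLyapunov gf φ Vs Vf αfl αfu χf αf lf1 lf2)
    -- condition on the slow dynamics
    (ρsl : ℝ → ℝ) (hρsl : ClassP ρsl)
    (hslowRate : ∀ x z d, max (γs (Vf z x)) (χs ‖d‖) ≤ Vs x → ρsl (Vs x) ≤ ρs x z d)
    -- condition on the fast dynamics
    (γf ρsu ρfl : ℝ → ℝ) (hγf : ClassKInf γf) (hρsu : ClassP ρsu) (hρfl : ClassP ρfl)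
    (hsmallgain : ∀ r, 0 < r → γf (γs r) < r)
    (hdominance : ∀ r, 0 < r → ρsu r * (lf1 r + lf2 (kInv γf r)) < ρfl r * αf r)
    (hfastRate : ∀ x z d w,
      max (γf (Vs x)) (max (γf (χs ‖d‖)) (χf ‖w‖)) ≤ Vf z x →
        ρs x z d * ‖gs x z d‖ ≤ ρsu (Vf z x) ∧ ρfl (Vf z x) ≤ ρf z x w) :
    IsISS (shiftedSystem ρs gs ρf gf (φ 0)) ∧
    (∃ σ : ℝ → ℝ, ScalingFunction γs γf σ) ∧
    ∀ σ : ℝ → ℝ, ScalingFunction γs γf σ →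
      PosDefRadiallyUnbounded φ (maxLyapunov Vs Vf σ) ∧
      ∃ α : ℝ → ℝ, ClassPD α ∧ ∀ x z d w,
        DifferentiableAt ℝ (fun a : Euc n × Euc m => maxLyapunov Vs Vf σ a.1 a.2) (x, z) →
        max (χs ‖d‖) (σ (χf ‖w‖)) ≤ maxLyapunov Vs Vf σ x z →
        fderiv ℝ (fun x' => maxLyapunov Vs Vf σ x' z) x (ρs x z d • gs x z d) +
            fderiv ℝ (fun z' => maxLyapunov Vs Vf σ x z') z (ρf z x w • gf z x w) ≤
          -α (maxLyapunov Vs Vf σ x z) := by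
  have hσ_ex := exists_scalingFunction hslow.gain_class hγf hsmallgain
  refine ⟨?_, hσ_ex, fun σ hσ => ⟨maxLyapunov_posDefRadiallyUnbounded hslow hfast hσ.classKInf, ?_⟩⟩
  · obtain ⟨σ, hσ⟩ := hσ_ex
    have hK := hσ.classKInf
    obtain ⟨α, hαc, hαpos, hα⟩ := exists_decay_rate hρs hρf hslow hfast hρsl hslowRate hγf hρsu hρfl
      hdominance hfastRate hσ
    obtain ⟨κ, hκ, hκc, hκd, hκα⟩ := exists_exponential_rescaling hαc hαpos
    obtain ⟨α₁, α₂, hα₁, hα₂, hbd⟩ := maxLyapunov_posDefRadiallyUnbounded hslow hfast hK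
    obtain ⟨ω, hωc, hωm, hω0, hω⟩ := exists_growth_modulus hφ.lipschitz.continuous
    have hθ := classKInf_id_add hωc.continuousOn hωm hω0
    -- With `θ = id + ω`, the map `A = θ ∘ α₁⁻¹ ∘ κ⁻¹` recovers the state norm from `κ(V)`, and `B =
    -- κ ∘ α₂ ∘ θ` bounds `κ(V)` by the state norm; hence `β(s, t) = A(e⁻ᵗ B(s))`.
    have hA := hθ.comp (hα₁.kInv.comp hκ.kInv)
    have hB := hκ.comp (hα₂.comp hθ)
    have hgain := hslow.input_gain_class.max (hK.comp hfast.input_gain_class)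
    refine (shiftedSystem_regularRHS hregs hregf (φ 0)).isISS_of_estimate (hA.classKL_exp hB)
      (hA.comp (hκ.comp hgain)).toClassK fun u T c ξ hc0 hc hξ t ht => ?_
    have hV0 : ∀ x z, 0 ≤ maxLyapunov Vs Vf σ x z := fun x z =>
      (hslow.nonneg x).trans (le_max_left _ _)
    have hupper : κ (maxLyapunov Vs Vf σ (ξ 0).fst ((ξ 0).snd + φ 0)) ≤
        κ (α₂ (‖ξ 0‖ + ω ‖ξ 0‖)) := by
      refine hκ.mono (hV0 _ _) ((hbd _ _).2.trans (hα₂.mono (norm_nonneg _) ?_))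
      refine norm_eucProd_shift_le hωm hω _ _ rfl (le_of_eq ?_)
      rw [← norm_neg]
      congr 1
      change -((ξ 0).snd + φ 0 - φ (ξ 0).fst - (ξ 0).snd) = φ (ξ 0).fst - φ 0
      abel
    have hlower : ‖ξ t‖ ≤ (fun r => r + ω r)
        (kInv α₁ (kInv κ (κ (maxLyapunov Vs Vf σ (ξ t).fst ((ξ t).snd + φ 0))))) := by
      rw [hκ.kInv_apply (hV0 _ _)]
      refine le_trans ?_ (hθ.mono (norm_nonneg _)
        ((hα₁.le_kInv_iff (norm_nonneg _) (hV0 _ _)).2 (hbd _ _).1))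
      refine norm_eucProd_shift_le hωm hω _ _ rfl (le_of_eq ?_)
      congr 1
      change (ξ t).snd - ((ξ t).snd + φ 0 - φ (ξ t).fst) = φ (ξ t).fst - φ 0
      abel
    have hmain := maxLyapunov_le_along_solution hregs hregf hslow.contDiff hfast.contDiff hslow.nonneg
      hfast.nonneg hσ hslow.input_gain_class.toClassK hfast.input_gain_class.toClassK hα hκ hκc hκd hκα
      hc0 hc hξ ht
    refine hlower.trans ((hA.mono (hκ.nonneg (hV0 _ _)) hmain).trans ?_)
    rw [hA.strictMono.monotoneOn.map_max
      (mul_nonneg (Real.exp_pos _).le (hκ.nonneg (hV0 _ _)))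
      (hκ.nonneg (hgain.nonneg hc0))]
    refine max_le_max (hA.mono (mul_nonneg (Real.exp_pos _).le (hκ.nonneg (hV0 _ _))) ?_) le_rfl
    exact mul_le_mul_of_nonneg_left hupper (Real.exp_pos _).le
  · obtain ⟨α, hαc, hαpos, hα⟩ := exists_decay_rate hρs hρf hslow hfast hρsl hslowRate hγf hρsu hρfl
      hdominance hfastRate hσ
    obtain ⟨α', hα', hdec⟩ := exists_classPD_decay hslow.contDiff hfast.contDiff hslow.nonneg
      hfast.nonneg hσ hαc hαpos
    exact ⟨α', hα', fun x z d w hdiff hin => hdec x z _ _ hdiff fun hpos => hα x z d w hpos hin⟩
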